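/- \textbf{Setting.} Let $\mathcal X$ be a compact metric space with a Borel probability measure $\mu$, and let $K:\mathcal X\times\mathcal X\to\mathbb R$ be continuous. Suppose that $K$ has an eigenfunction (Karhunen--Lo\`eve) expansion with respect to $\mu$: there are $\lambda_1\ge\lambda_2\ge\dots\ge 0$ and continuous functions $\phi_e$ (for the indices $e$ with $\lambda_e>0$) such that $$\lambda_e\phi_e(x)=\int_{\mathcal X}K(x,x')\phi_e(x')\,d\mu(x'),\qquad \int_{\mathcal X}\phi_i\phi_j\,d\mu=\delta_{ij},\qquad K(x,x')=\sum_{e:\lambda_e>0}\lambda_e\phi_e(x)\phi_e(x')$$ for all $x,x'\in\mathcal X$ (the sequence $\lambda_e$ is padded with zeros when $K$ has finite rank), and suppose that there is $k<\infty$ with $\sup_{x}|\phi_e(x)|\le\sqrt k$ for all these $e$. Let $f$ be a measurable zero-mean Gaussian process on $\mathcal X$ with covariance $K$, let $x_1,x_2,\dots$ be random points of $\mathcal X$ with law $\mu$, let $\nu_1,\nu_2,\dots\sim\mathcal N(0,\sigma_\nu^2)$ with $\sigma_\nu^2>0$, let $f,x_1,x_2,\dots,\nu_1,\nu_2,\dots$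 be mutually independent (precisely: for some $\sigma$-algebra $\mathcal F_f$ of events, $(x,\omega)\mapsto f(x,\omega)$ is $\mathcal B(\mathcal X)\otimes\mathcal F_f$-measurable and $\mathcal F_f,\sigma(x_1),\sigma(x_2),\dots,\sigma(\nu_1),\sigma(\nu_2),\dots$ are independent), and put $y_m=f(x_m)+\nu_m$. For $M\ge 1$ write $\boldsymbol x=(x_1,\dots,x_M)$ and $\boldsymbol y=(y_1,\dots,y_M)^T$. Fix an integer $E\ge1$ with $\lambda_E>0$, let $\Lambda_E=\mathrm{diag}(\lambda_1,\dots,\lambda_E)$ and let $G$ be the $M\times E$ matrix with entries $G_{me}=\phi_e(x_m)$. Define $$\widehat f_A(x)=[\phi_1(x),\dots,\phi_E(x)]\Big(\tfrac{G^TG}{M}+\tfrac{\sigma_\nu^2}{M}\Lambda_E^{-1}\Big)^{-1}\tfrac{G^T}{M}\,\boldsymbol y,\qquad \widehat f_B(x)=[\phi_1(x),\dots,\phi_E(x)]\Big(I+\tfrac{\sigma_\nu^2}{M}\Lambda_E^{-1}\Big)^{-1}\tfrac{G^T}{M}\,\boldsymbol y,$$ and, with $\|g\|^2=\int_{\mathcal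 X}g^2\,d\mu$, let $\mathrm{Err}_A(\boldsymbol x)=\mathbb E\big[\|f-\widehat f_A\|^2\,\big|\,\boldsymbol x\big]$ and $\mathrm{Err}_B(\boldsymbol x)=\mathbb E\big[\|f-\widehat f_B\|^2\,\big|\,\boldsymbol x\big]$. \textbf{Theorem.} The sum $\sum_e\lambda_e$ is finite and, for fixed $E$, as $M\to\infty$, $$\mathrm{Err}_A(\boldsymbol x)\to\sum_{e=E+1}^{\infty}\lambda_e\quad\text{and}\quad \mathrm{Err}_B(\boldsymbol x)\to\sum_{e=E+1}^{\infty}\lambda_e\qquad\text{in probability.}$$ This limit is the best possible error of an $E$-dimensional estimator: for every $M$, every $E$-dimensional vector space $V$ of real functions on $\mathcal X$ fixed in advance, and every estimator $\widehat f_\star$ that is a (measurable) function of $\boldsymbol x$ and $\boldsymbol y$ with values in $V$, $$\mathbb E\big[\|f-\widehat f_\star\|^2\,\big|\,\boldsymbol x\big]\ \ge\ \sum_{e=E+1}^{\infty}\lambda_e\qquad\text{almost surely.}$$ Hence both estimators are asymptotically optimal among $E$-dimensional estimators. -/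

import Mathlib

open MeasureTheory ProbabilityTheory Filter Matrix
open scoped NNReal ENNReal Topology

noncomputable section

namespace GPRegression

/-- `lam 0 ≥ lam 1 ≥ ⋯ ≥ 0` and `phi 0, phi 1, …` form the Karhunen-Loève (eigenfunction)
expansion of the kernel `K` with respect to `μ`. The positive entries of `lam` are the eigenvalues;
if there are only finitely many of them (`K` has finite rank), `lam` is padded with zeros, and
nothing is asked of `phi e` when `lam e = 0`. Indices start at `0`. -/
structure IsKLExpansion {X : Type*} [TopologicalSpace X] [MeasurableSpace X]
    (μ : Measure X) (K : X → X → ℝ) (lam : ℕ → ℝ) (phi : ℕ → X → ℝ) : Prop where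
  nonneg : ∀ e, 0 ≤ lam e
  antitone : Antitone lam
  continuous : ∀ e, 0 < lam e → Continuous (phi e)
  eigen : ∀ e, 0 < lam e → ∀ x, lam e * phi e x = ∫ x', K x x' * phi e x' ∂μ
  orthonormal : ∀ i j, 0 < lam i → 0 < lam j →
    ∫ x, phi i x * phi j x ∂μ = if i = j then 1 else 0
  expansion : ∀ x x', HasSum (fun e => lam e * phi e x * phi e x') (K x x')

/-- The measurement model `y m = f (xs m) + nu m`: the inputs `xs 0, xs 1, …` have law `μ`, the
noises `nu 0, nu 1, …` have law `N(0, σ2)`, `f` is a zero-mean Gaussian process with covariance `K`,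
and `f, xs 0, xs 1, …, nu 0, nu 1, …` are mutually independent.

`f` is a measurable random function: `(x, ω) ↦ f x ω` is measurable for the product of the Borel
σ-algebra and a σ-algebra `mF` on `Ω`, the information carried by `f`, and it is `mF` that is
independent of the inputs and the noises. (Joint measurability alone would allow to change `f x`
on the null event `xs m = x`, and so to change every measurement.) -/
structure IsMeasurementModel {X Ω : Type*} [TopologicalSpace X] [mX : MeasurableSpace X]
    [mΩ : MeasurableSpace Ω] (P : Measure Ω) (μ : Measure X) (K : X → X → ℝ) (σ2 : ℝ≥0)
    (f : X → Ω → ℝ) (xs : ℕ → Ω → X) (nu : ℕ → Ω → ℝ) : Prop where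
  measurable_input : ∀ m, Measurable (xs m)
  law_input : ∀ m, P.map (xs m) = μ
  measurable_noise : ∀ m, Measurable (nu m)
  law_noise : ∀ m, P.map (nu m) = gaussianReal 0 σ2
  gaussian : IsGaussianProcess f P
  mean_zero : ∀ x, ∫ ω, f x ω ∂P = 0
  covariance_eq : ∀ x x', cov[f x, f x'; P] = K x x'
  indep : ∃ mF : MeasurableSpace Ω, mF ≤ mΩ ∧
    @Measurable (X × Ω) ℝ (@Prod.instMeasurableSpace X Ω mX mF) _ (fun p => f p.1 p.2) ∧
    @iIndep Ω (Unit ⊕ ℕ ⊕ ℕ)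
      (Sum.elim (fun _ => mF)
        (Sum.elim (fun m => MeasurableSpace.comap (xs m) mX)
          (fun m => MeasurableSpace.comap (nu m) Real.measurableSpace))) mΩ P

/-- The `M × E` matrix with entries `phi e (x m)`. -/
def designMatrix {X : Type*} (phi : ℕ → X → ℝ) (E M : ℕ) (x : Fin M → X) :
    Matrix (Fin M) (Fin E) ℝ :=
  Matrix.of fun m e => phi e (x m)

/-- The diagonal matrix of the first `E` eigenvalues. -/
def eigenvalueMatrix (lam : ℕ → ℝ) (E : ℕ) : Matrix (Fin E) (Fin E) ℝ :=
  Matrix.diagonal fun e => lam e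

/-- `H_A = (Gᵀ G / M + (σ2 / M) Λ⁻¹)⁻¹ Gᵀ / M`. -/
def matrixHA {X : Type*} (lam : ℕ → ℝ) (phi : ℕ → X → ℝ) (σ2 : ℝ≥0) (E M : ℕ) (x : Fin M → X) :
    Matrix (Fin E) (Fin M) ℝ :=
  ((1 / (M : ℝ)) • ((designMatrix phi E M x)ᵀ * designMatrix phi E M x)
      + ((σ2 : ℝ) / M) • (eigenvalueMatrix lam E)⁻¹)⁻¹
    * ((1 / (M : ℝ)) • (designMatrix phi E M x)ᵀ)

/-- `H_B = (I + (σ2 / M) Λ⁻¹)⁻¹ Gᵀ / M`. -/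
def matrixHB {X : Type*} (lam : ℕ → ℝ) (phi : ℕ → X → ℝ) (σ2 : ℝ≥0) (E M : ℕ) (x : Fin M → X) :
    Matrix (Fin E) (Fin M) ℝ :=
  (1 + ((σ2 : ℝ) / M) • (eigenvalueMatrix lam E)⁻¹)⁻¹
    * ((1 / (M : ℝ)) • (designMatrix phi E M x)ᵀ)

/-- The estimator `f̂_A`, as a function of the inputs, the measurements and the evaluation point. -/
def estimatorA {X : Type*} (lam : ℕ → ℝ) (phi : ℕ → X → ℝ) (σ2 : ℝ≥0) (E M : ℕ)
    (x : Fin M → X) (y : Fin M → ℝ) (t : X) : ℝ :=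
  (fun e : Fin E => phi e t) ⬝ᵥ (matrixHA lam phi σ2 E M x *ᵥ y)

/-- The estimator `f̂_B`, as a function of the inputs, the measurements and the evaluation point. -/
def estimatorB {X : Type*} (lam : ℕ → ℝ) (phi : ℕ → X → ℝ) (σ2 : ℝ≥0) (E M : ℕ)
    (x : Fin M → X) (y : Fin M → ℝ) (t : X) : ℝ :=
  (fun e : Fin E => phi e t) ⬝ᵥ (matrixHB lam phi σ2 E M x *ᵥ y)

/-- The first `M` inputs. -/
def inputs {X Ω : Type*} (xs : ℕ → Ω → X) (M : ℕ) (ω : Ω) : Fin M → X :=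
  fun m => xs m ω

/-- The first `M` measurements `y m = f (xs m) + nu m`. -/
def measurements {X Ω : Type*} (f : X → Ω → ℝ) (xs : ℕ → Ω → X) (nu : ℕ → Ω → ℝ) (M : ℕ) (ω : Ω) :
    Fin M → ℝ :=
  fun m => f (xs m ω) ω + nu m ω

/-- `‖g‖² = ∫ g² dμ ∈ [0, ∞]`. -/
def sqNorm {X : Type*} [MeasurableSpace X] (μ : Measure X) (g : X → ℝ) : ℝ≥0∞ :=
  ∫⁻ t, ENNReal.ofReal (g t ^ 2) ∂μ

/-- The error `E[‖f - f̂‖² | x 0, …, x (M - 1)] : Ω → [0, ∞]` of an estimator `f̂` built from `M`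
inputs and measurements, as a conditional expectation of a nonnegative random variable. -/
def condError {X Ω : Type*} [mX : MeasurableSpace X] [MeasurableSpace Ω] (P : Measure Ω)
    (μ : Measure X) (f : X → Ω → ℝ) (xs : ℕ → Ω → X) (nu : ℕ → Ω → ℝ) (M : ℕ)
    (fhat : (Fin M → X) → (Fin M → ℝ) → X → ℝ) : Ω → ℝ≥0∞ :=
  condLExp (MeasurableSpace.comap (inputs xs M) MeasurableSpace.pi) P
    (fun ω => sqNorm μ fun t => f t ω - fhat (inputs xs M ω) (measurements f xs nu M ω) t)

end GPRegression

end

/-! By Pythagoras in `L²(μ)`, the squared distance from `f` to `∑ b_i v_i`, with `v` orthonormal, is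
a residual depending on `f` and `v` only, plus `∑ (⟨f, v_i⟩ - b_i)²`. Since `f` is independent of
the inputs, conditioning on them replaces the residual by its mean `∑ λ_e - ∑_i E⟨f, v_i⟩²`, and the
expansion of the kernel gives `E⟨f, v⟩² = ∑_e λ_e ⟨φ_e, v⟩²`.

Lower bound: the `v_i` capture `∑_e λ_e c_e` with `c_e = ∑_i ⟨φ_e, v_i⟩²`. Bessel's inequality gives
`c_e ≤ 1` when applied to `φ_e`, and `∑ c_e ≤ E` when applied to each `v_i`. Such weights capture at
most the `E` largest eigenvalues (`sum_mul_le_sum_range`), so the mean residual is at least the tail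
(`HasSecondMoment.tail_le_integral_residual`).

Limits: for the first `E` eigenfunctions the mean residual equals the tail, so it remains to show
that the error of the estimated coefficients vanishes. Empirical means have mean square error
`O(1/M)` (`integral_empirical_mean_sub_sq_le`) and the ridge terms are `O(1/M)`; this settles
`f̂_B`. For `f̂_A` the empirical Gram matrix must also be inverted. On the event that it is within
`1/2` of the identity the inversion costs a bounded factor (`sum_sub_inv_mulVec_sq_le`). That event
is determined by the inputs and its probability tends to one, so a conditional Markov inequality
restricted to it suffices (`tendstoInMeasure_const_add_condLExp`). -/

set_option linter.unusedSectionVars false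

universe u

noncomputable section

namespace GPRegression

/-! ### Trace and quadratic form of the kernel -/

section KarhunenLoeve

variable {X : Type*} [TopologicalSpace X] [CompactSpace X] [MeasurableSpace X] [BorelSpace X]
  {μ : Measure X} [IsProbabilityMeasure μ] {K : X → X → ℝ} {lam : ℕ → ℝ} {phi : ℕ → X → ℝ}

lemma exists_kernel_bound (hK : Continuous (Function.uncurry K)) :
    ∃ B, ∀ x x', |K x x'| ≤ B := by
  obtain ⟨B, hB⟩ := isCompact_univ.exists_bound_of_continuousOn hK.continuousOn
  exact ⟨B, fun x x' => hB (x, x') (Set.mem_univ _)⟩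

lemma IsKLExpansion.measurable_phi (h : IsKLExpansion μ K lam phi) {e : ℕ} (he : 0 < lam e) :
    Measurable (phi e) := (h.continuous e he).measurable

lemma IsKLExpansion.memLp_phi (h : IsKLExpansion μ K lam phi) {e : ℕ} (he : 0 < lam e)
    (p : ℝ≥0∞) : MemLp (phi e) p μ := by
  obtain ⟨C, hC⟩ := isCompact_univ.exists_bound_of_continuousOn (h.continuous e he).continuousOn
  exact MemLp.of_bound (h.measurable_phi he).aestronglyMeasurable C
    (ae_of_all _ fun x => hC x (Set.mem_univ _))

lemma IsKLExpansion.integrable_term (h : IsKLExpansion μ K lam phi) (e : ℕ) :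
    Integrable (fun x => lam e * phi e x * phi e x) μ := by
  rcases (h.nonneg e).eq_or_lt with he | he
  · simp [← he]
  · simp_rw [mul_assoc]
    exact ((h.memLp_phi he 2).integrable_mul (h.memLp_phi he 2)).const_mul _

lemma IsKLExpansion.integral_term (h : IsKLExpansion μ K lam phi) (e : ℕ) :
    ∫ x, lam e * phi e x * phi e x ∂μ = lam e := by
  rcases (h.nonneg e).eq_or_lt with he | he
  · simp [← he]
  · simp_rw [mul_assoc]
    rw [integral_const_mul, h.orthonormal e e he he]; simp

lemma IsKLExpansion.term_nonneg (h : IsKLExpansion μ K lam phi) (e : ℕ) (x : X) :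
    0 ≤ lam e * phi e x * phi e x := by
  rw [mul_assoc]; exact mul_nonneg (h.nonneg e) (mul_self_nonneg _)

lemma continuous_diag (hK : Continuous (Function.uncurry K)) : Continuous (fun x => K x x) :=
  hK.comp (continuous_id.prodMk continuous_id)

lemma integrable_diag (μ : Measure X) [IsProbabilityMeasure μ]
    (hK : Continuous (Function.uncurry K)) : Integrable (fun x => K x x) μ := by
  obtain ⟨B, hB⟩ := exists_kernel_bound hK
  exact Integrable.of_bound (continuous_diag hK).measurable.aestronglyMeasurable B
    (ae_of_all _ fun x => hB x x)

/-- Each `λ_e` is the integral of a nonnegative term of the expansion of `K x x`, so the partial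
sums are bounded by the trace. -/
lemma IsKLExpansion.summable (h : IsKLExpansion μ K lam phi)
    (hK : Continuous (Function.uncurry K)) : Summable lam := by
  refine summable_of_sum_range_le (c := ∫ x, K x x ∂μ) h.nonneg fun n => ?_
  calc ∑ e ∈ Finset.range n, lam e
      = ∑ e ∈ Finset.range n, ∫ x, lam e * phi e x * phi e x ∂μ := by simp [h.integral_term]
    _ = ∫ x, ∑ e ∈ Finset.range n, lam e * phi e x * phi e x ∂μ :=
        (integral_finsetSum _ fun e _ => h.integrable_term e).symm
    _ ≤ ∫ x, K x x ∂μ := by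
        refine integral_mono (integrable_finsetSum _ fun e _ => h.integrable_term e)
          (integrable_diag μ hK) fun x => ?_
        exact sum_le_hasSum _ (fun e _ => h.term_nonneg e x) (h.expansion x x)

lemma IsKLExpansion.integral_diag (h : IsKLExpansion μ K lam phi)
    (hK : Continuous (Function.uncurry K)) : ∫ x, K x x ∂μ = ∑' e, lam e := by
  have := hasSum_integral_of_summable_integral_norm (μ := μ)
    (F := fun e x => lam e * phi e x * phi e x) h.integrable_term (by
      simp_rw [Real.norm_of_nonneg (h.term_nonneg _ _), h.integral_term]; exact h.summable hK)
  simp_rw [h.integral_term, (h.expansion _ _).tsum_eq] at this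
  exact this.tsum_eq.symm

/-- The quadratic form of the kernel, diagonalised by its eigenfunctions. -/
lemma IsKLExpansion.hasSum_quadratic [SecondCountableTopology X] (h : IsKLExpansion μ K lam phi)
    (hK : Continuous (Function.uncurry K)) {k : ℝ} (hk : ∀ e, 0 < lam e → ∀ x, |phi e x| ≤ √k)
    {v : X → ℝ} (hv : Integrable v μ) :
    HasSum (fun e => lam e * (∫ x, phi e x * v x ∂μ) ^ 2)
      (∫ p, K p.1 p.2 * (v p.1 * v p.2) ∂(μ.prod μ)) := by
  have hpv : ∀ e, 0 < lam e → Integrable (fun x => phi e x * v x) μ := fun e he =>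
    hv.bdd_mul (h.measurable_phi he).aestronglyMeasurable (ae_of_all _ fun x => hk e he x)
  let F : ℕ → X × X → ℝ := fun e p => lam e * ((phi e p.1 * v p.1) * (phi e p.2 * v p.2))
  have hF : ∀ e, Integrable (F e) (μ.prod μ) := by
    intro e
    rcases (h.nonneg e).eq_or_lt with he | he
    · simp [F, ← he]
    · exact ((hpv e he).mul_prod (hpv e he)).const_mul _
  have hn : ∀ e, ∫ p, ‖F e p‖ ∂(μ.prod μ) = lam e * (∫ x, |phi e x * v x| ∂μ) ^ 2 := by
    intro e
    simp only [F, norm_mul, Real.norm_of_nonneg (h.nonneg e)]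
    rw [integral_const_mul, sq]
    congr 1
    rw [← integral_prod_mul]
    simp [abs_mul]
  have hs : Summable fun e => ∫ p, ‖F e p‖ ∂(μ.prod μ) := by
    simp_rw [hn]
    -- The uniform bound on the eigenfunctions dominates the terms by `λ_e (√k ‖v‖₁)²`, so sum and
    -- integral can be exchanged for merely integrable `v`.
    refine Summable.of_nonneg_of_le (fun e => mul_nonneg (h.nonneg e) (sq_nonneg _)) (fun e => ?_)
      ((h.summable hK).mul_right ((√k * ∫ x, |v x| ∂μ) ^ 2))
    rcases (h.nonneg e).eq_or_lt with he | he
    · simp [← he]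
    · refine mul_le_mul_of_nonneg_left ?_ he.le
      refine pow_le_pow_left₀ (integral_nonneg fun x => abs_nonneg _) ?_ 2
      rw [← integral_const_mul]
      refine integral_mono (hpv e he).abs (hv.abs.const_mul _) fun x => ?_
      simp only [abs_mul]
      exact mul_le_mul_of_nonneg_right (hk e he x) (abs_nonneg _)
  have hsum := hasSum_integral_of_summable_integral_norm hF hs
  have h1 : ∀ e, ∫ p, F e p ∂(μ.prod μ) = lam e * (∫ x, phi e x * v x ∂μ) ^ 2 := fun e => by
    simp only [F]
    rw [integral_const_mul, integral_prod_mul (fun x => phi e x * v x) (fun x => phi e x * v x), sq]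
  have h2 : ∀ p : X × X, ∑' e, F e p = K p.1 p.2 * (v p.1 * v p.2) := fun p => by
    simp only [F]
    rw [← (h.expansion p.1 p.2).tsum_eq, ← tsum_mul_right]
    exact tsum_congr fun e => by ring
  simpa only [h1, h2] using hsum

end KarhunenLoeve

/-! ### Second moments of the coefficients of a random function -/

section SecondMoments

variable {X W : Type*} [TopologicalSpace X] [CompactSpace X] [SecondCountableTopology X]
  [MeasurableSpace X] [BorelSpace X] [MeasurableSpace W]
  {μ : Measure X} [IsProbabilityMeasure μ] {Q : Measure W} [IsProbabilityMeasure Q]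
  {K : X → X → ℝ} {lam : ℕ → ℝ} {phi : ℕ → X → ℝ}

/-- A jointly measurable random function with second-moment kernel `K`. -/
structure HasSecondMoment (Q : Measure W) (K : X → X → ℝ) (F : X → W → ℝ) : Prop where
  measurable : Measurable (Function.uncurry F)
  memLp : ∀ x, MemLp (F x) 2 Q
  moment : ∀ x x', ∫ w, F x w * F x' w ∂Q = K x x'

variable {F : X → W → ℝ}

lemma HasSecondMoment.measurable_swap (hF : HasSecondMoment Q K F) :
    Measurable (fun p : W × X => F p.2 p.1) := hF.measurable.comp _root_.measurable_swap

/-- Tonelli, integrating over the randomness first: the inner integral is `K x x`, which is bounded.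
-/
lemma HasSecondMoment.memLp_uncurry (hF : HasSecondMoment Q K F)
    (hK : Continuous (Function.uncurry K)) :
    MemLp (fun p : W × X => F p.2 p.1) 2 (Q.prod μ) := by
  rw [memLp_two_iff_integrable_sq hF.measurable_swap.aestronglyMeasurable,
    integrable_prod_iff' (hF.measurable_swap.pow_const 2).aestronglyMeasurable]
  refine ⟨ae_of_all _ fun x => (hF.memLp x).integrable_sq, ?_⟩
  convert integrable_diag μ hK using 2 with x
  rw [← hF.moment x x]
  simp [sq]

lemma HasSecondMoment.integral_sq (hF : HasSecondMoment Q K F)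
    (hK : Continuous (Function.uncurry K)) (h : IsKLExpansion μ K lam phi) :
    ∫ w, ∫ x, F x w ^ 2 ∂μ ∂Q = ∑' e, lam e := by
  rw [integral_integral_swap (f := fun w x => F x w ^ 2) (hF.memLp_uncurry hK).integrable_sq,
    ← h.integral_diag hK]
  simp_rw [← hF.moment, sq]

lemma HasSecondMoment.ae_memLp (hF : HasSecondMoment Q K F)
    (hK : Continuous (Function.uncurry K)) : ∀ᵐ w ∂Q, MemLp (fun x => F x w) 2 μ := by
  filter_upwards [(hF.memLp_uncurry (μ := μ) hK).integrable_sq.prod_right_ae] with w hw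
  exact (memLp_two_iff_integrable_sq
    (hF.measurable.comp (measurable_id.prodMk measurable_const)).aestronglyMeasurable).2 hw

/-- Justifies Fubini for the squared coefficient: `|F x F x'| ≤ (F x² + F x'²) / 2`, whose mean is
at most the bound `B` of the kernel. -/
lemma HasSecondMoment.integrable_product (hF : HasSecondMoment Q K F)
    (hK : Continuous (Function.uncurry K)) {v : X → ℝ} (hv : Integrable v μ) :
    Integrable (fun p : W × X × X => (F p.2.1 p.1 * v p.2.1) * (F p.2.2 p.1 * v p.2.2))
      (Q.prod (μ.prod μ)) := by
  obtain ⟨B, hB⟩ := exists_kernel_bound hK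
  have m1 : Measurable fun p : W × X × X => F p.2.1 p.1 :=
    hF.measurable.comp (measurable_snd.fst.prodMk measurable_fst)
  have m2 : Measurable fun p : W × X × X => F p.2.2 p.1 :=
    hF.measurable.comp (measurable_snd.snd.prodMk measurable_fst)
  have mFF := m1.mul m2
  have hvv : Integrable (fun p : X × X => v p.1 * v p.2) (μ.prod μ) := hv.mul_prod hv
  have hm : AEStronglyMeasurable
      (fun p : W × X × X => (F p.2.1 p.1 * v p.2.1) * (F p.2.2 p.1 * v p.2.2))
      (Q.prod (μ.prod μ)) := by
    have := mFF.aestronglyMeasurable.mul (hvv.aestronglyMeasurable.comp_snd (μ := Q))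
    refine this.congr (ae_of_all _ fun p => ?_)
    simp only [Pi.mul_apply]; ring
  have hint : ∀ p : X × X, Integrable (fun w => F p.1 w * F p.2 w) Q := fun p =>
    (hF.memLp p.1).integrable_mul (hF.memLp p.2)
  rw [integrable_prod_iff' hm]
  refine ⟨ae_of_all _ fun p => ?_, ?_⟩
  · convert (hint p).mul_const (v p.1 * v p.2) using 2 with w
    ring
  · refine (hvv.norm.const_mul B).mono' hm.norm.prod_swap.integral_prod_right' (ae_of_all _ fun p => ?_)
    rw [Real.norm_of_nonneg (integral_nonneg fun w => norm_nonneg _)]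
    have : ∀ w, ‖F p.1 w * v p.1 * (F p.2 w * v p.2)‖
        = |F p.1 w * F p.2 w| * ‖v p.1 * v p.2‖ := fun w => by
      rw [← Real.norm_eq_abs, ← norm_mul]; congr 1; ring
    simp_rw [this]
    rw [integral_mul_const]
    refine mul_le_mul_of_nonneg_right ?_ (norm_nonneg _)
    calc ∫ w, |F p.1 w * F p.2 w| ∂Q
        ≤ ∫ w, (F p.1 w * F p.1 w + F p.2 w * F p.2 w) / 2 ∂Q := by
          refine integral_mono (hint p).abs
            (((hint (p.1, p.1)).add (hint (p.2, p.2))).div_const 2) fun w => ?_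
          simp only [abs_mul]
          nlinarith [sq_nonneg (|F p.1 w| - |F p.2 w|), abs_mul_abs_self (F p.1 w),
            abs_mul_abs_self (F p.2 w)]
      _ = (K p.1 p.1 + K p.2 p.2) / 2 := by
          rw [integral_div, integral_add (hint (p.1, p.1)) (hint (p.2, p.2)), hF.moment, hF.moment]
      _ ≤ B := by linarith [(abs_le.1 (hB p.1 p.1)).2, (abs_le.1 (hB p.2 p.2)).2]

/-- The coefficient of a random function along `v`. -/
def coeff (μ : Measure X) (F : X → W → ℝ) (v : X → ℝ) (w : W) : ℝ := ∫ x, F x w * v x ∂μ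

lemma HasSecondMoment.measurable_coeff (hF : HasSecondMoment Q K F) {v : X → ℝ}
    (hv : Measurable v) : Measurable (coeff μ F v) :=
  ((hF.measurable_swap.mul (hv.comp measurable_snd)).stronglyMeasurable.integral_prod_right'
    (f := fun p : W × X => F p.2 p.1 * v p.2)).measurable

lemma HasSecondMoment.integrable_coeff_sq (hF : HasSecondMoment Q K F)
    (hK : Continuous (Function.uncurry K)) {v : X → ℝ} (hv : Integrable v μ) :
    Integrable (fun w => coeff μ F v w ^ 2) Q := by
  convert (hF.integrable_product hK hv).integral_prod_left using 2 with w
  rw [integral_prod_mul (fun x => F x w * v x) (fun x => F x w * v x), coeff, sq]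

/-- A squared coefficient is a double integral over `X × X`; averaging inside it turns `F x F x'`
into `K x x'` and leaves the quadratic form of the kernel. -/
lemma HasSecondMoment.hasSum_coeff_sq (hF : HasSecondMoment Q K F)
    (hK : Continuous (Function.uncurry K)) (h : IsKLExpansion μ K lam phi)
    {k : ℝ} (hk : ∀ e, 0 < lam e → ∀ x, |phi e x| ≤ √k)
    {v : X → ℝ} (hv : Integrable v μ) :
    HasSum (fun e => lam e * (∫ x, phi e x * v x ∂μ) ^ 2) (∫ w, coeff μ F v w ^ 2 ∂Q) := by
  convert h.hasSum_quadratic hK hk hv using 1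
  have h1 : ∀ w, coeff μ F v w ^ 2
      = ∫ p : X × X, (F p.1 w * v p.1) * (F p.2 w * v p.2) ∂(μ.prod μ) := fun w => by
    rw [integral_prod_mul (fun x => F x w * v x) (fun x => F x w * v x), coeff, sq]
  simp_rw [h1]
  rw [integral_integral_swap (f := fun w (p : X × X) => (F p.1 w * v p.1) * (F p.2 w * v p.2))
    (hF.integrable_product hK hv)]
  refine integral_congr_ae (ae_of_all _ fun p => ?_)
  simp only
  rw [← hF.moment, ← integral_mul_const]
  refine integral_congr_ae (ae_of_all _ fun w => ?_)
  simp only; ring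

lemma HasSecondMoment.integral_coeff_phi_sq (hF : HasSecondMoment Q K F)
    (hK : Continuous (Function.uncurry K)) (h : IsKLExpansion μ K lam phi)
    {k : ℝ} (hk : ∀ e, 0 < lam e → ∀ x, |phi e x| ≤ √k) {i : ℕ} (hi : 0 < lam i) :
    ∫ w, coeff μ F (phi i) w ^ 2 ∂Q = lam i := by
  refine (hF.hasSum_coeff_sq hK h hk ((h.memLp_phi hi 1).integrable le_rfl)).unique ?_
  have : (fun e => lam e * (∫ x, phi e x * phi i x ∂μ) ^ 2) = fun e => if e = i then lam i else 0 := by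
    funext e
    rcases (h.nonneg e).eq_or_lt with he | he
    · have : e ≠ i := by rintro rfl; exact hi.ne he
      simp [← he, this]
    · rw [h.orthonormal e i he hi]
      split_ifs with hei
      · simp [hei]
      · simp
  rw [this]
  exact hasSum_ite_eq i (lam i)

end SecondMoments

/-! ### An `L²` law of large numbers with a random integrand -/

section MonteCarlo

variable {W Z Ω : Type*} [MeasurableSpace W] [MeasurableSpace Z] [MeasurableSpace Ω]
  {Q : Measure W} [IsProbabilityMeasure Q] {κ : Measure Z} [IsProbabilityMeasure κ]
  {P : Measure Ω} [IsProbabilityMeasure P]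

/-- A function of `(w, z)`, centered in `z`. -/
def centered (κ : Measure Z) (h : W × Z → ℝ) (p : W × Z) : ℝ := h p - ∫ z, h (p.1, z) ∂κ

lemma measurable_centered {h : W × Z → ℝ} (hh : Measurable h) : Measurable (centered κ h) :=
  hh.sub ((hh.stronglyMeasurable.integral_prod_right' (ν := κ)).measurable.comp measurable_fst)

lemma integral_centered (h : W × Z → ℝ) (w : W) : ∫ z, centered κ h (w, z) ∂κ = 0 := by
  by_cases hi : Integrable (fun z => h (w, z)) κ
  · simp only [centered]
    rw [integral_sub hi (integrable_const _)]
    simp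
  -- For a non-integrable section the subtracted mean is the default value `0`, and so is the
  -- integral of what is left; hence the identity holds for every `w`.
  · simp only [centered, integral_undef hi, sub_zero]

lemma ae_integral_centered_sq_le {h : W × Z → ℝ} (hh : Measurable h)
    (hL : MemLp h 2 (Q.prod κ)) : ∀ᵐ w ∂Q, Integrable (fun z => centered κ h (w, z) ^ 2) κ ∧
      ∫ z, centered κ h (w, z) ^ 2 ∂κ ≤ ∫ z, h (w, z) ^ 2 ∂κ := by
  filter_upwards [hL.integrable_sq.prod_right_ae] with w hw
  have hm : Measurable fun z => h (w, z) := hh.comp measurable_prodMk_left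
  have hw2 : MemLp (fun z => h (w, z)) 2 κ :=
    (memLp_two_iff_integrable_sq hm.aestronglyMeasurable).2 hw
  refine ⟨(hw2.sub (memLp_const (∫ z, h (w, z) ∂κ))).integrable_sq, ?_⟩
  have := variance_le_expectation_sq (μ := κ) hm.aestronglyMeasurable
  rw [variance_eq_integral hm.aemeasurable] at this
  exact this

lemma memLp_centered {h : W × Z → ℝ} (hh : Measurable h) (hL : MemLp h 2 (Q.prod κ)) :
    MemLp (centered κ h) 2 (Q.prod κ) := by
  have hm := measurable_centered (κ := κ) hh
  rw [memLp_two_iff_integrable_sq hm.aestronglyMeasurable,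
    integrable_prod_iff (hm.pow_const 2).aestronglyMeasurable]
  refine ⟨(ae_integral_centered_sq_le hh hL).mono fun w hw => hw.1, ?_⟩
  refine hL.integrable_sq.integral_prod_left.mono'
    (hm.pow_const 2).aestronglyMeasurable.norm.integral_prod_right' ?_
  filter_upwards [ae_integral_centered_sq_le hh hL] with w hw
  rw [Real.norm_of_nonneg (integral_nonneg fun z => norm_nonneg _)]
  simpa [Real.norm_of_nonneg, sq_nonneg] using hw.2

lemma integral_centered_sq_le {h : W × Z → ℝ} (hh : Measurable h) (hL : MemLp h 2 (Q.prod κ)) :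
    ∫ p, centered κ h p ^ 2 ∂(Q.prod κ) ≤ ∫ p, h p ^ 2 ∂(Q.prod κ) := by
  have hc := (memLp_centered hh hL).integrable_sq
  rw [integral_prod _ hc, integral_prod _ hL.integrable_sq]
  exact integral_mono_ae hc.integral_prod_left hL.integrable_sq.integral_prod_left
    ((ae_integral_centered_sq_le hh hL).mono fun w hw => hw.2)

/-- Mean square error of the empirical mean of a random function `h (g, ·)` over a sample that
is pairwise independent and independent of `g`. -/
lemma integral_empirical_mean_sub_sq_le {g : Ω → W} {z : ℕ → Ω → Z} (hg : Measurable g)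
    (hz : ∀ m, Measurable (z m))
    (h1 : ∀ m, P.map (fun ω => (g ω, z m ω)) = Q.prod κ)
    (h2 : ∀ m n, m ≠ n → P.map (fun ω => (g ω, z m ω, z n ω)) = Q.prod (κ.prod κ))
    {h : W × Z → ℝ} (hh : Measurable h) (hL : MemLp h 2 (Q.prod κ)) {hbar : W → ℝ}
    (hbar_eq : ∀ᵐ w ∂Q, ∫ z, h (w, z) ∂κ = hbar w) (M : ℕ) (hM : 0 < M) :
    Integrable (fun ω => ((1 / (M : ℝ)) * ∑ m : Fin M, h (g ω, z m ω) - hbar (g ω)) ^ 2) P ∧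
      ∫ ω, ((1 / (M : ℝ)) * ∑ m : Fin M, h (g ω, z m ω) - hbar (g ω)) ^ 2 ∂P
        ≤ (∫ p, h p ^ 2 ∂(Q.prod κ)) / M := by
  have hc := measurable_centered (κ := κ) hh
  have hM' : (M : ℝ) ≠ 0 := by positivity
  let Y : ℕ → Ω → ℝ := fun m ω => centered κ h (g ω, z m ω)
  have hgz : ∀ m, Measurable fun ω => (g ω, z m ω) := fun m => hg.prodMk (hz m)
  have hY : ∀ m, MemLp (Y m) 2 P := fun m => by
    have := memLp_centered hh hL
    rw [← h1 m] at this
    exact (memLp_map_measure_iff hc.aestronglyMeasurable (hgz m).aemeasurable).1 this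
  have hYi : ∀ m n, Integrable (fun ω => Y m ω * Y n ω) P := fun m n =>
    (hY m).integrable_mul (hY n)
  have hdiag : ∀ m, ∫ ω, Y m ω * Y m ω ∂P ≤ ∫ p, h p ^ 2 ∂(Q.prod κ) := fun m => by
    refine le_trans (le_of_eq ?_) (integral_centered_sq_le hh hL)
    rw [← h1 m, integral_map (hgz m).aemeasurable (hc.pow_const 2).aestronglyMeasurable]
    simp only [Y, sq]
  -- For fixed `w` the two sample points are independent, so the product integrates to a product of
  -- two centered means. Only the `M` diagonal terms survive, which gives the rate `1 / M`.
  have hoff : ∀ m n, m ≠ n → ∫ ω, Y m ω * Y n ω ∂P = 0 := fun m n hmn => by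
    let G : W × Z × Z → ℝ := fun p => centered κ h (p.1, p.2.1) * centered κ h (p.1, p.2.2)
    have hG : Measurable G :=
      (hc.comp (measurable_fst.prodMk measurable_snd.fst)).mul
        (hc.comp (measurable_fst.prodMk measurable_snd.snd))
    have hmap : AEMeasurable (fun ω => (g ω, z m ω, z n ω)) P :=
      (hg.prodMk ((hz m).prodMk (hz n))).aemeasurable
    have hGi : Integrable G (Q.prod (κ.prod κ)) := by
      rw [← h2 m n hmn, integrable_map_measure hG.aestronglyMeasurable hmap]
      exact hYi m n
    calc ∫ ω, Y m ω * Y n ω ∂P = ∫ p, G p ∂(Q.prod (κ.prod κ)) := by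
          rw [← h2 m n hmn, integral_map hmap hG.aestronglyMeasurable]
      _ = 0 := by
          rw [integral_prod _ hGi]
          refine integral_eq_zero_of_ae (ae_of_all _ fun w => ?_)
          simp only [G, Pi.zero_apply]
          rw [integral_prod_mul (fun z => centered κ h (w, z)) (fun z => centered κ h (w, z)),
            integral_centered, zero_mul]
  have hae : ∀ᵐ ω ∂P, ((1 / (M : ℝ)) * ∑ m : Fin M, h (g ω, z m ω) - hbar (g ω)) ^ 2
      = (1 / (M : ℝ) ^ 2) * ∑ m : Fin M, ∑ n : Fin M, Y m ω * Y n ω := by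
    -- `Q` is the first marginal of the joint law, so the almost sure identity for `hbar` can be
    -- pulled back along `g`.
    have hgQ : P.map g = Q := by
      have := congrArg (Measure.map Prod.fst) (h1 0)
      rw [Measure.map_map measurable_fst (hgz 0)] at this
      simpa [Function.comp_def, Measure.map_fst_prod] using this
    rw [← hgQ] at hbar_eq
    filter_upwards [ae_of_ae_map hg.aemeasurable hbar_eq] with ω hω
    rw [← Finset.sum_mul_sum]
    have : ∑ m : Fin M, Y m ω = ∑ m : Fin M, h (g ω, z m ω) - M * hbar (g ω) := by
      simp [Y, centered, hω, Finset.sum_sub_distrib]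
    rw [this]
    field_simp
  have hint : Integrable (fun ω => (1 / (M : ℝ) ^ 2) * ∑ m : Fin M, ∑ n : Fin M, Y m ω * Y n ω) P :=
    (integrable_finsetSum _ fun (m : Fin M) _ =>
      integrable_finsetSum _ fun (n : Fin M) _ => hYi m n).const_mul _
  refine ⟨hint.congr (hae.mono fun ω h => h.symm), ?_⟩
  rw [integral_congr_ae hae, integral_const_mul, integral_finsetSum _ fun (m : Fin M) _ =>
    integrable_finsetSum _ fun (n : Fin M) _ => hYi m n]
  have : ∀ m : Fin M, ∫ ω, ∑ n : Fin M, Y m ω * Y n ω ∂P ≤ ∫ p, h p ^ 2 ∂(Q.prod κ) := fun m => by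
    rw [integral_finsetSum _ fun (n : Fin M) _ => hYi m n, Finset.sum_eq_single m]
    · exact hdiag m
    · intro n _ hn
      exact hoff m n fun h => hn (Fin.ext h.symm)
    · simp
  calc (1 / (M : ℝ) ^ 2) * ∑ m : Fin M, ∫ ω, ∑ n : Fin M, Y m ω * Y n ω ∂P
      ≤ (1 / (M : ℝ) ^ 2) * ∑ m : Fin M, ∫ p, h p ^ 2 ∂(Q.prod κ) := by
        gcongr with m; exact this m
    _ = (∫ p, h p ^ 2 ∂(Q.prod κ)) / M := by
        simp; field_simp

end MonteCarlo

/-! ### Orthonormal families and finite-dimensional spaces of functions -/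

section Projection

variable {X : Type*} [MeasurableSpace X] {μ : Measure X}

lemma sqNorm_eq {u : X → ℝ} (hu : MemLp u 2 μ) : sqNorm μ u = ENNReal.ofReal (∫ x, u x ^ 2 ∂μ) :=
  (ofReal_integral_eq_lintegral_ofReal hu.integrable_sq (ae_of_all _ fun _ => sq_nonneg _)).symm

lemma sqNorm_congr {u v : X → ℝ} (h : u =ᵐ[μ] v) : sqNorm μ u = sqNorm μ v :=
  lintegral_congr_ae (h.mono fun x hx => by simp only [hx])

lemma memLp_of_sqNorm_ne_top {u : X → ℝ} (hm : AEStronglyMeasurable u μ) (h : sqNorm μ u ≠ ∞) :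
    MemLp u 2 μ := by
  rw [memLp_two_iff_integrable_sq hm]
  refine ⟨(hm.pow 2), ?_⟩
  rw [hasFiniteIntegral_iff_ofReal (ae_of_all _ fun _ => sq_nonneg _)]
  exact lt_top_iff_ne_top.2 h

/-- A finite orthonormal family of square-integrable functions. -/
structure IsOrthonormalFamily {ι : Type*} [DecidableEq ι] (μ : Measure X) (v : ι → X → ℝ) :
    Prop where
  measurable : ∀ i, Measurable (v i)
  memLp : ∀ i, MemLp (v i) 2 μ
  orthonormal : ∀ i j, ∫ x, v i x * v j x ∂μ = if i = j then 1 else 0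

variable {ι : Type*} [Fintype ι] [DecidableEq ι] {v : ι → X → ℝ}

lemma IsOrthonormalFamily.memLp_combination (hv : IsOrthonormalFamily μ v) (b : ι → ℝ) :
    MemLp (fun x => ∑ i, b i * v i x) 2 μ :=
  memLp_finsetSum _ fun i _ => (hv.memLp i).const_mul (b i)

/-- Pythagoras for the distance to a linear combination of an orthonormal family. -/
lemma IsOrthonormalFamily.integral_sub_sq (hv : IsOrthonormalFamily μ v) {u : X → ℝ}
    (hu : MemLp u 2 μ) (b : ι → ℝ) :
    ∫ x, (u x - ∑ i, b i * v i x) ^ 2 ∂μ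
      = (∫ x, u x ^ 2 ∂μ - ∑ i, (∫ x, u x * v i x ∂μ) ^ 2)
        + ∑ i, (∫ x, u x * v i x ∂μ - b i) ^ 2 := by
  have huv : ∀ i, Integrable (fun x => u x * v i x) μ := fun i => hu.integrable_mul (hv.memLp i)
  have hvv : ∀ i j, Integrable (fun x => v i x * v j x) μ := fun i j =>
    (hv.memLp i).integrable_mul (hv.memLp j)
  have i1 : Integrable (fun x => ∑ i, 2 * b i * (u x * v i x)) μ :=
    integrable_finsetSum _ fun i _ => (huv i).const_mul _
  have i2 : Integrable (fun x => ∑ i, ∑ j, b i * b j * (v i x * v j x)) μ :=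
    integrable_finsetSum _ fun i _ => integrable_finsetSum _ fun j _ => (hvv i j).const_mul _
  have hexp : ∀ x, (u x - ∑ i, b i * v i x) ^ 2
      = u x ^ 2 - ∑ i, 2 * b i * (u x * v i x) + ∑ i, ∑ j, b i * b j * (v i x * v j x) := fun x => by
    have h2 : ∑ i, ∑ j, b i * b j * (v i x * v j x) = (∑ i, b i * v i x) ^ 2 := by
      rw [sq, Finset.sum_mul_sum]
      exact Finset.sum_congr rfl fun i _ => Finset.sum_congr rfl fun j _ => by ring
    have h1 : ∑ i, 2 * b i * (u x * v i x) = 2 * u x * ∑ i, b i * v i x := by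
      rw [Finset.mul_sum]
      exact Finset.sum_congr rfl fun i _ => by ring
    rw [h1, h2]; ring
  have i3 : Integrable (fun x => u x ^ 2 - ∑ i, 2 * b i * (u x * v i x)) μ :=
    hu.integrable_sq.sub i1
  simp_rw [hexp]
  rw [integral_add i3 i2, integral_sub hu.integrable_sq i1,
    integral_finsetSum _ fun i _ => (huv i).const_mul _,
    integral_finsetSum _ fun i _ => integrable_finsetSum _ fun j _ => (hvv i j).const_mul _]
  simp_rw [integral_finsetSum _ fun j _ => (hvv _ j).const_mul _, integral_const_mul,
    hv.orthonormal]
  simp only [mul_ite, mul_one, mul_zero, Finset.sum_ite_eq, Finset.mem_univ, if_true]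
  rw [sub_add, sub_add, ← Finset.sum_sub_distrib, ← Finset.sum_sub_distrib]
  congr 1
  exact Finset.sum_congr rfl fun i _ => by ring

lemma IsOrthonormalFamily.bessel (hv : IsOrthonormalFamily μ v) {u : X → ℝ} (hu : MemLp u 2 μ) :
    ∑ i, (∫ x, u x * v i x ∂μ) ^ 2 ≤ ∫ x, u x ^ 2 ∂μ := by
  have h := hv.integral_sub_sq hu fun i => ∫ x, u x * v i x ∂μ
  have h0 : 0 ≤ ∫ x, (u x - ∑ i, (∫ x, u x * v i x ∂μ) * v i x) ^ 2 ∂μ :=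
    integral_nonneg fun x => sq_nonneg _
  simp only [sub_self, ne_eq, OfNat.ofNat_ne_zero, not_false_eq_true, zero_pow,
    Finset.sum_const_zero, add_zero] at h
  linarith

/-- The part of the squared norm of `u` that is not captured by the family `v`. -/
def residual (μ : Measure X) (v : ι → X → ℝ) (u : X → ℝ) : ℝ :=
  ∫ x, u x ^ 2 ∂μ - ∑ i, (∫ x, u x * v i x ∂μ) ^ 2

lemma IsOrthonormalFamily.residual_nonneg (hv : IsOrthonormalFamily μ v) {u : X → ℝ}
    (hu : MemLp u 2 μ) : 0 ≤ residual μ v u := sub_nonneg.2 (hv.bessel hu)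

lemma IsOrthonormalFamily.sqNorm_sub (hv : IsOrthonormalFamily μ v) {u : X → ℝ}
    (hu : MemLp u 2 μ) (b : ι → ℝ) :
    sqNorm μ (fun x => u x - ∑ i, b i * v i x)
      = ENNReal.ofReal (residual μ v u)
        + ENNReal.ofReal (∑ i, (∫ x, u x * v i x ∂μ - b i) ^ 2) := by
  have hL : MemLp (fun x => u x - ∑ i, b i * v i x) 2 μ := hu.sub (hv.memLp_combination b)
  rw [sqNorm_eq hL, hv.integral_sub_sq hu b]
  exact ENNReal.ofReal_add (hv.residual_nonneg hu) (Finset.sum_nonneg fun i _ => sq_nonneg _)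

lemma isOrthonormalFamily_coe {S : Submodule ℝ (Lp ℝ 2 μ)} (B : OrthonormalBasis ι ℝ S) :
    IsOrthonormalFamily μ fun i => ((B i : Lp ℝ 2 μ) : X → ℝ) where
  measurable i := (Lp.stronglyMeasurable _).measurable
  memLp i := Lp.memLp _
  orthonormal i j := by
    have h := orthonormal_iff_ite.1 B.orthonormal i j
    rw [Submodule.coe_inner, L2.inner_def] at h
    rw [← h]
    exact integral_congr_ae (ae_of_all _ fun x => mul_comm _ _)

lemma ae_eq_combination_of_mem {S : Submodule ℝ (Lp ℝ 2 μ)} (B : OrthonormalBasis ι ℝ S)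
    (t : S) : ((t : Lp ℝ 2 μ) : X → ℝ)
      =ᵐ[μ] fun x => ∑ i, B.repr t i * ((B i : Lp ℝ 2 μ) : X → ℝ) x := by
  have ht : (t : Lp ℝ 2 μ) = ∑ i, B.repr t i • (B i : Lp ℝ 2 μ) := by
    have := congrArg Subtype.val (B.sum_repr t)
    rw [Submodule.coe_sum] at this
    exact this.symm
  have h1 : ∀ᵐ x ∂μ, ∀ i, ((B.repr t i • (B i : Lp ℝ 2 μ) : Lp ℝ 2 μ) : X → ℝ) x
      = B.repr t i * ((B i : Lp ℝ 2 μ) : X → ℝ) x := by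
    rw [ae_all_iff]
    intro i
    filter_upwards [Lp.coeFn_smul (B.repr t i) (B i : Lp ℝ 2 μ)] with x hx
    exact hx
  conv_lhs => rw [ht]
  filter_upwards [h1, Lp.coeFn_finsetSum Finset.univ
    fun i => (B.repr t i • (B i : Lp ℝ 2 μ) : Lp ℝ 2 μ)] with x hx hs
  rw [hs, Finset.sum_apply]
  exact Finset.sum_congr rfl fun i _ => hx i

/-- The square-integrable elements of a finite-dimensional space of functions are, up to null sets,
combinations of an orthonormal family with no more elements than the dimension. -/
lemma exists_isOrthonormalFamily (μ : Measure X) (V : Submodule ℝ (X → ℝ)) [FiniteDimensional ℝ V] :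
    ∃ n ≤ Module.finrank ℝ V, ∃ v : Fin n → X → ℝ, IsOrthonormalFamily μ v ∧
      ∀ u ∈ V, MemLp u 2 μ → ∃ b : Fin n → ℝ, u =ᵐ[μ] fun x => ∑ i, b i * v i x := by
  -- `V` may contain functions outside `L²`, and distinct functions that agree almost everywhere.
  -- Restricting to `L²` and passing to classes can only lower the dimension; the family consists of
  -- representatives of an orthonormal basis of the image.
  let V' : Submodule ℝ V :=
    { carrier := {u | MemLp (u : X → ℝ) 2 μ}
      add_mem' := fun ha hb => MemLp.add ha hb
      zero_mem' := MemLp.zero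
      smul_mem' := fun c _ ha => MemLp.const_smul ha c }
  let T : V' →ₗ[ℝ] Lp ℝ 2 μ :=
    { toFun := fun u => MemLp.toLp _ u.2
      map_add' := fun a b => MemLp.toLp_add a.2 b.2
      map_smul' := fun c a => MemLp.toLp_const_smul c a.2 }
  refine ⟨_, (LinearMap.finrank_range_le T).trans (Submodule.finrank_le V'), _,
    isOrthonormalFamily_coe (stdOrthonormalBasis ℝ (LinearMap.range T)), fun u hu hL => ?_⟩
  let t : LinearMap.range T := ⟨T ⟨⟨u, hu⟩, hL⟩, ⟨_, rfl⟩⟩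
  exact ⟨fun i => (stdOrthonormalBasis ℝ (LinearMap.range T)).repr t i,
    hL.coeFn_toLp.symm.trans (ae_eq_combination_of_mem _ t)⟩

end Projection

/-! ### A rearrangement inequality, and the expected residual -/

/-- Weights in `[0, 1]` of total mass at most `E` capture at most the `E` largest values. -/
lemma sum_mul_le_sum_range {lam c : ℕ → ℝ} (hl : Antitone lam) (h0 : ∀ e, 0 ≤ lam e)
    (c0 : ∀ e, 0 ≤ c e) (c1 : ∀ e, c e ≤ 1) {E : ℕ}
    (hc : ∀ N, ∑ e ∈ Finset.range N, c e ≤ E) (N : ℕ) :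
    ∑ e ∈ Finset.range N, lam e * c e ≤ ∑ e ∈ Finset.range E, lam e := by
  -- Enlarging the range lets the sum be split at `E` whatever the size of `N`.
  have hmono : ∑ e ∈ Finset.range N, lam e * c e ≤ ∑ e ∈ Finset.range (E + N), lam e * c e :=
    Finset.sum_le_sum_of_subset_of_nonneg (Finset.range_mono (by omega))
      fun e _ _ => mul_nonneg (h0 e) (c0 e)
  refine hmono.trans ?_
  have hE := hc (E + N)
  rw [Finset.sum_range_add] at hE ⊢
  have h1 : ∑ i ∈ Finset.range N, lam (E + i) * c (E + i)
      ≤ lam E * ∑ i ∈ Finset.range N, c (E + i) := by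
    rw [Finset.mul_sum]
    exact Finset.sum_le_sum fun i _ => mul_le_mul_of_nonneg_right (hl (by omega)) (c0 _)
  have h2 : lam E * ∑ i ∈ Finset.range N, c (E + i)
      ≤ lam E * (E - ∑ e ∈ Finset.range E, c e) :=
    mul_le_mul_of_nonneg_left (by linarith) (h0 E)
  -- The mass lying beyond `E` is at most the mass missing below `E`, and moving it there can only
  -- increase the eigenvalue attached to it.
  have h3 : lam E * (E - ∑ e ∈ Finset.range E, c e) = ∑ e ∈ Finset.range E, lam E * (1 - c e) := by
    rw [← Finset.mul_sum, Finset.sum_sub_distrib]; simp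
  have h4 : ∑ e ∈ Finset.range E, lam e * c e + ∑ e ∈ Finset.range E, lam E * (1 - c e)
      ≤ ∑ e ∈ Finset.range E, lam e := by
    rw [← Finset.sum_add_distrib]
    refine Finset.sum_le_sum fun e he => ?_
    have := mul_le_mul_of_nonneg_right (hl (Finset.mem_range.1 he).le) (sub_nonneg.2 (c1 e))
    linarith
  linarith

section ExpectedResidual

variable {X W : Type*} [TopologicalSpace X] [CompactSpace X] [SecondCountableTopology X]
  [MeasurableSpace X] [BorelSpace X] [MeasurableSpace W]
  {μ : Measure X} [IsProbabilityMeasure μ] {Q : Measure W} [IsProbabilityMeasure Q]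
  {K : X → X → ℝ} {lam : ℕ → ℝ} {phi : ℕ → X → ℝ} {F : X → W → ℝ}
  {ι : Type*} [Fintype ι] [DecidableEq ι] {v : ι → X → ℝ}

lemma IsKLExpansion.isOrthonormalFamily (h : IsKLExpansion μ K lam phi) {E : ℕ}
    (hlam : ∀ e < E, 0 < lam e) : IsOrthonormalFamily μ fun i : Fin E => phi i where
  measurable i := h.measurable_phi (hlam i i.2)
  memLp i := h.memLp_phi (hlam i i.2) 2
  orthonormal i j := by
    rw [h.orthonormal i j (hlam i i.2) (hlam j j.2)]
    simp [Fin.ext_iff]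

lemma HasSecondMoment.measurable_residual (hF : HasSecondMoment Q K F)
    (hv : IsOrthonormalFamily μ v) : Measurable fun w => residual μ v fun x => F x w := by
  refine Measurable.sub ?_ (Finset.measurable_sum _ fun i _ =>
    (hF.measurable_coeff (hv.measurable i)).pow_const 2)
  exact ((hF.measurable_swap.pow_const 2).stronglyMeasurable.integral_prod_right' (ν := μ)).measurable

lemma HasSecondMoment.integrable_residual (hF : HasSecondMoment Q K F)
    (hK : Continuous (Function.uncurry K)) (hv : IsOrthonormalFamily μ v) :
    Integrable (fun w => residual μ v fun x => F x w) Q := by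
  refine Integrable.sub (hF.memLp_uncurry hK).integrable_sq.integral_prod_left ?_
  exact integrable_finsetSum _ fun i _ =>
    hF.integrable_coeff_sq hK ((hv.memLp i).integrable one_le_two)

lemma HasSecondMoment.integral_residual (hF : HasSecondMoment Q K F)
    (hK : Continuous (Function.uncurry K)) (h : IsKLExpansion μ K lam phi)
    (hv : IsOrthonormalFamily μ v) :
    ∫ w, residual μ v (fun x => F x w) ∂Q
      = ∑' e, lam e - ∑ i, ∫ w, coeff μ F (v i) w ^ 2 ∂Q := by
  have hi : ∀ i, Integrable (fun w => coeff μ F (v i) w ^ 2) Q := fun i =>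
    hF.integrable_coeff_sq hK ((hv.memLp i).integrable one_le_two)
  rw [← hF.integral_sq hK h, ← integral_finsetSum _ fun i _ => hi i,
    ← integral_sub (hF.memLp_uncurry hK).integrable_sq.integral_prod_left
      (integrable_finsetSum _ fun i _ => hi i)]
  rfl

lemma HasSecondMoment.integral_residual_phi (hF : HasSecondMoment Q K F)
    (hK : Continuous (Function.uncurry K)) (h : IsKLExpansion μ K lam phi)
    {k : ℝ} (hk : ∀ e, 0 < lam e → ∀ x, |phi e x| ≤ √k) {E : ℕ} (hlam : ∀ e < E, 0 < lam e) :
    ∫ w, residual μ (fun i : Fin E => phi i) (fun x => F x w) ∂Q = ∑' e, lam (E + e) := by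
  rw [hF.integral_residual hK h (h.isOrthonormalFamily hlam)]
  simp_rw [fun i : Fin E => hF.integral_coeff_phi_sq hK h hk (hlam i i.2)]
  rw [Fin.sum_univ_eq_sum_range, ← (h.summable hK).sum_add_tsum_nat_add E]
  simp [add_comm]

/-- The eigenfunctions leave the smallest expected residual. -/
lemma HasSecondMoment.tail_le_integral_residual (hF : HasSecondMoment Q K F)
    (hK : Continuous (Function.uncurry K)) (h : IsKLExpansion μ K lam phi)
    {k : ℝ} (hk : ∀ e, 0 < lam e → ∀ x, |phi e x| ≤ √k) {E : ℕ}
    (hv : IsOrthonormalFamily μ v) (hcard : Fintype.card ι ≤ E) :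
    ∑' e, lam (E + e) ≤ ∫ w, residual μ v (fun x => F x w) ∂Q := by
  -- Nothing is known about `phi e` when `lam e = 0`, so those weights are set to `0`; this does not
  -- change `lam e * c e`.
  let c : ℕ → ℝ := fun e => if 0 < lam e then ∑ i, (∫ x, phi e x * v i x ∂μ) ^ 2 else 0
  have c0 : ∀ e, 0 ≤ c e := fun e => by
    simp only [c]; split_ifs
    · exact Finset.sum_nonneg fun i _ => sq_nonneg _
    · exact le_rfl
  have c1 : ∀ e, c e ≤ 1 := fun e => by
    simp only [c]; split_ifs with he
    · refine (hv.bessel (h.memLp_phi he 2)).trans (le_of_eq ?_)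
      simpa [sq] using h.orthonormal e e he he
    · exact zero_le_one
  -- Bessel with the roles exchanged: each unit vector `v i` is expanded in the eigenfunctions, and
  -- there are at most `E` of them.
  have hc : ∀ N, ∑ e ∈ Finset.range N, c e ≤ E := fun N => by
    let J := {e : Fin N // 0 < lam e}
    have hphi : IsOrthonormalFamily μ fun e : J => phi e.1 :=
      ⟨fun e => h.measurable_phi e.2, fun e => h.memLp_phi e.2 2, fun a b => by
        rw [h.orthonormal _ _ a.2 b.2]
        exact if_congr (by rw [Subtype.ext_iff, Fin.ext_iff]) rfl rfl⟩
    have hb : ∀ i, ∑ e : J, (∫ x, phi e.1 x * v i x ∂μ) ^ 2 ≤ 1 := fun i => by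
      have := hphi.bessel (hv.memLp i)
      have h1 : ∫ x, v i x ^ 2 ∂μ = 1 := by simpa [sq] using hv.orthonormal i i
      rw [h1] at this
      simpa only [mul_comm] using this
    calc ∑ e ∈ Finset.range N, c e = ∑ e : Fin N, c e := (Fin.sum_univ_eq_sum_range c N).symm
      _ = ∑ e : J, ∑ i, (∫ x, phi e.1 x * v i x ∂μ) ^ 2 := by
          simp only [c]
          rw [← Finset.sum_filter]
          exact Finset.sum_subtype _ (by simp) _
      _ = ∑ i, ∑ e : J, (∫ x, phi e.1 x * v i x ∂μ) ^ 2 := Finset.sum_comm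
      _ ≤ ∑ _i : ι, (1 : ℝ) := Finset.sum_le_sum fun i _ => hb i
      _ ≤ E := by simpa using hcard
  have hs : HasSum (fun e => lam e * c e) (∑ i, ∫ w, coeff μ F (v i) w ^ 2 ∂Q) := by
    convert hasSum_sum fun i (_ : i ∈ Finset.univ) =>
      hF.hasSum_coeff_sq hK h hk ((hv.memLp i).integrable one_le_two) using 2 with e
    rcases (h.nonneg e).eq_or_lt with he | he
    · simp [← he]
    · simp [c, he, Finset.mul_sum]
  have hle : ∑ i, ∫ w, coeff μ F (v i) w ^ 2 ∂Q ≤ ∑ e ∈ Finset.range E, lam e :=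
    le_of_tendsto' hs.tendsto_sum_nat (sum_mul_le_sum_range h.antitone h.nonneg c0 c1 hc)
  rw [hF.integral_residual hK h hv, ← (h.summable hK).sum_add_tsum_nat_add E]
  simp only [add_comm _ E] at hle ⊢
  linarith

end ExpectedResidual

/-! ### Conditional expectations and convergence in probability -/

section ConditionalError

variable {Ω W Y : Type*} [mΩ : MeasurableSpace Ω] [MeasurableSpace W] [mY : MeasurableSpace Y]
  {P : Measure Ω} [IsProbabilityMeasure P]

lemma condLExp_comp_of_indepFun {g : Ω → W} {y : Ω → Y} (hg : Measurable g) (hy : Measurable y)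
    (hgy : IndepFun g y P) {r : W → ℝ≥0∞} (hr : Measurable r) :
    condLExp (mY.comap y) P (fun ω => r (g ω)) =ᵐ[P] fun _ => ∫⁻ w, r w ∂(P.map g) := by
  refine (ae_eq_condLExp hy.comap_le P _ measurable_const ?_).symm
  rintro s ⟨t, ht, rfl⟩
  have h1 : Measurable (t.indicator (fun _ => (1 : ℝ≥0∞))) := measurable_const.indicator ht
  have h2 : ∀ ω, (y ⁻¹' t).indicator (fun ω => r (g ω)) ω
      = ((fun ω => r (g ω)) * fun ω => t.indicator (fun _ => (1 : ℝ≥0∞)) (y ω)) ω := fun ω => by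
    by_cases hω : y ω ∈ t <;> simp [hω]
  rw [lintegral_const, Measure.restrict_apply_univ, ← lintegral_indicator (hy ht)]
  simp_rw [h2]
  rw [lintegral_mul_eq_lintegral_mul_lintegral_of_indepFun (f := fun ω => r (g ω))
    (g := fun ω => t.indicator (fun _ => (1 : ℝ≥0∞)) (y ω)) (hr.comp hg) (h1.comp hy)
    (hgy.comp hr h1), lintegral_map hr hg]
  congr 1
  have h3 : ∀ ω, t.indicator (fun _ => (1 : ℝ≥0∞)) (y ω)
      = (y ⁻¹' t).indicator (fun _ => 1) ω := fun ω => rfl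
  simp_rw [h3]
  rw [lintegral_indicator (hy ht)]
  simp

/-- Markov's inequality on `S`; as `S` belongs to `m`, the conditional expectation and `A` have the
same integral over it. No control of `A` off `S` is needed. -/
lemma measure_ge_condLExp_le {m : MeasurableSpace Ω} (hm : m ≤ mΩ) (A : Ω → ℝ≥0∞) {S : Set Ω}
    (hS : MeasurableSet[m] S) {ε : ℝ≥0∞} (hε : ε ≠ 0) (hε' : ε ≠ ∞) :
    P {ω | ε ≤ condLExp m P A ω} ≤ P Sᶜ + (∫⁻ ω in S, A ω ∂P) / ε := by
  have h1 : P {ω | ε ≤ condLExp m P A ω} ≤ P Sᶜ + P ({ω | ε ≤ condLExp m P A ω} ∩ S) := by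
    refine (measure_mono fun ω hω => ?_).trans (measure_union_le _ _)
    by_cases h : ω ∈ S
    · exact Or.inr ⟨hω, h⟩
    · exact Or.inl h
  refine h1.trans (add_le_add le_rfl ?_)
  rw [← setLIntegral_condLExp hm P A hS, ← Measure.restrict_apply' (hm _ hS)]
  exact meas_ge_le_lintegral_div (measurable_condLExp' _ _ _).aemeasurable hε hε'

/-- Reduces convergence in measure to `c` to smallness of the excess `r`. It fails for `c = ∞`,
where the distance is `0`. -/
lemma edist_const_add_self {c : ℝ≥0∞} (hc : c ≠ ∞) (r : ℝ≥0∞) : edist (c + r) c = r := by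
  lift c to ℝ≥0 using hc
  induction r with
  | top =>
    rw [add_top, ENNReal.edist_eq_top_iff]
    simp
  | coe r =>
    rw [← ENNReal.coe_add]
    change edist (c + r) c = r
    rw [edist_nndist, nndist_comm, NNReal.nndist_eq]
    simp [add_left_comm (r : ℝ≥0)]

lemma tendstoInMeasure_const_add_condLExp {m : ℕ → MeasurableSpace Ω} (hm : ∀ M, m M ≤ mΩ)
    {Z : ℕ → Ω → ℝ≥0∞} {A : ℕ → Ω → ℝ≥0∞} {c : ℝ≥0∞} (hc : c ≠ ∞)
    (hZ : ∀ M, Z M =ᵐ[P] fun ω => c + condLExp (m M) P (A M) ω)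
    {S : ℕ → Set Ω} (hS : ∀ M, MeasurableSet[m M] (S M))
    (hSlim : Tendsto (fun M => P (S M)ᶜ) atTop (𝓝 0))
    (hA : Tendsto (fun M => ∫⁻ ω in S M, A M ω ∂P) atTop (𝓝 0)) :
    TendstoInMeasure P Z atTop fun _ => c := by
  refine tendstoInMeasure_of_ne_top fun ε hε hε' => ?_
  have hlim : Tendsto (fun M => P (S M)ᶜ + (∫⁻ ω in S M, A M ω ∂P) / ε) atTop (𝓝 0) := by
    simpa using hSlim.add (ENNReal.Tendsto.div_const hA (Or.inr hε.ne'))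
  refine tendsto_of_tendsto_of_tendsto_of_le_of_le tendsto_const_nhds hlim
    (fun _ => zero_le) fun M => ?_
  refine le_trans (le_of_eq (measure_congr ?_))
    (measure_ge_condLExp_le (hm M) (A M) (hS M) hε.ne' hε')
  filter_upwards [hZ M] with ω hω
  have : edist (Z M ω) c = condLExp (m M) P (A M) ω := by
    rw [hω, edist_const_add_self hc]
  exact congrArg (fun t => ε ≤ t) this

end ConditionalError

/-! ### Linear systems close to the identity -/

section Perturbation

variable {n : Type*} [Fintype n] [DecidableEq n]

/-- `T - 1` has Frobenius norm at most `1/2`, so by Cauchy-Schwarz its quadratic form is at least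
`-|u|²/2`; the diagonal only adds to the form. `T` need not be symmetric. -/
lemma half_dotProduct_self_le {T : Matrix n n ℝ} {d : n → ℝ} (hd : ∀ i, 0 ≤ d i)
    (hT : ∑ i, ∑ j, (T i j - (1 : Matrix n n ℝ) i j) ^ 2 ≤ 1 / 4) (u : n → ℝ) :
    (1 / 2) * ∑ i, u i ^ 2 ≤ ∑ i, u i * ((T + diagonal d) *ᵥ u) i := by
  have h1 : ∑ i, u i * ((T + diagonal d) *ᵥ u) i
      = ∑ i, u i ^ 2 + ∑ i, ∑ j, (T i j - (1 : Matrix n n ℝ) i j) * (u i * u j)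
        + ∑ i, d i * u i ^ 2 := by
    rw [← Finset.sum_add_distrib, ← Finset.sum_add_distrib]
    refine Finset.sum_congr rfl fun i _ => ?_
    have h2 : ∑ j, (T i j - (1 : Matrix n n ℝ) i j) * (u i * u j)
        = u i * (T *ᵥ u) i - u i ^ 2 := by
      simp only [sub_mul, Finset.sum_sub_distrib, Matrix.one_apply, ite_mul, one_mul, zero_mul,
        Finset.sum_ite_eq, Finset.mem_univ, if_true, mulVec, dotProduct, Finset.mul_sum]
      congr 1
      · exact Finset.sum_congr rfl fun j _ => by ring
      · ring
    rw [h2, add_mulVec, Pi.add_apply, mulVec_diagonal]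
    ring
  have h3 := Finset.sum_mul_sq_le_sq_mul_sq (Finset.univ : Finset (n × n))
    (fun p => T p.1 p.2 - (1 : Matrix n n ℝ) p.1 p.2) fun p => u p.1 * u p.2
  have h4 : ∑ p : n × n, (u p.1 * u p.2) ^ 2 = (∑ i, u i ^ 2) ^ 2 := by
    rw [Fintype.sum_prod_type, sq (∑ i, u i ^ 2), Finset.sum_mul_sum]
    exact Finset.sum_congr rfl fun i _ => Finset.sum_congr rfl fun j _ => by ring
  rw [h4, Fintype.sum_prod_type, Fintype.sum_prod_type] at h3
  have h5 : 0 ≤ ∑ i, u i ^ 2 := Finset.sum_nonneg fun i _ => sq_nonneg _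
  have h6 : 0 ≤ ∑ i, d i * u i ^ 2 := Finset.sum_nonneg fun i _ => mul_nonneg (hd i) (sq_nonneg _)
  have h7 := abs_le_of_sq_le_sq
    (h3.trans ((mul_le_mul_of_nonneg_right hT (sq_nonneg _)).trans
      (le_of_eq (by ring : _ = ((1 / 2) * ∑ i, u i ^ 2) ^ 2)))) (by positivity)
  rw [h1]
  have h8 := (abs_le.1 h7).1
  simp only at h8
  linarith

/-- Solving with a matrix that is near the identity, plus a nonnegative diagonal, does not amplify
a residual by more than `2`. -/
lemma sum_sub_inv_mulVec_sq_le {T : Matrix n n ℝ} {d : n → ℝ} (hd : ∀ i, 0 ≤ d i)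
    (hT : ∑ i, ∑ j, (T i j - (1 : Matrix n n ℝ) i j) ^ 2 ≤ 1 / 4) (s a : n → ℝ) :
    ∑ i, (a i - ((T + diagonal d)⁻¹ *ᵥ s) i) ^ 2
      ≤ 4 * ∑ i, (((T + diagonal d) *ᵥ a) i - s i) ^ 2 := by
  set A := T + diagonal d with hA
  have hcoer := fun u : n → ℝ => half_dotProduct_self_le hd hT u
  rw [← hA] at hcoer
  -- Coercivity forces a trivial kernel, so the nonsingular inverse is a true inverse.
  have hunit : IsUnit A := by
    rw [← mulVec_injective_iff_isUnit]
    intro x y hxy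
    have h0 : A *ᵥ (x - y) = 0 := by rw [mulVec_sub, hxy, sub_self]
    have h1 := hcoer (x - y)
    rw [h0] at h1
    simp only [Pi.zero_apply, mul_zero, Finset.sum_const_zero] at h1
    have h2 : ∑ i, (x - y) i ^ 2 = 0 :=
      le_antisymm (by linarith) (Finset.sum_nonneg fun i _ => sq_nonneg _)
    rw [Finset.sum_eq_zero_iff_of_nonneg fun i _ => sq_nonneg _] at h2
    funext i
    exact sub_eq_zero.1 (pow_eq_zero_iff two_ne_zero |>.1 (h2 i (Finset.mem_univ i)))
  have hdet : IsUnit A.det := (isUnit_iff_isUnit_det A).1 hunit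
  set u := a - A⁻¹ *ᵥ s with hu
  have hAu : A *ᵥ u = A *ᵥ a - s := by
    rw [hu, mulVec_sub, mulVec_mulVec, mul_nonsing_inv _ hdet, one_mulVec]
  have h1 := hcoer u
  -- Young's inequality, weighted so that half of the coercivity constant `1/2` is left over; this
  -- produces the factor `4`.
  have h2 : ∑ i, u i * (A *ᵥ u) i ≤ ∑ i, (u i ^ 2 / 4 + (A *ᵥ u) i ^ 2) :=
    Finset.sum_le_sum fun i _ => by nlinarith [sq_nonneg (u i / 2 - (A *ᵥ u) i)]
  rw [Finset.sum_add_distrib, ← Finset.sum_div] at h2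
  have h3 : ∑ i, u i ^ 2 ≤ 4 * ∑ i, (A *ᵥ u) i ^ 2 := by linarith
  rw [hAu] at h3
  exact h3

end Perturbation

/-! ### Deterministic bounds for the coefficients of the two estimators -/

section Estimators

variable {X : Type*} {lam : ℕ → ℝ} {phi : ℕ → X → ℝ} {σ2 : ℝ≥0} {E M : ℕ}

/-- The ridge parameters `σ2 / (M λ_i)`. -/
def ridge (lam : ℕ → ℝ) (σ2 : ℝ≥0) (M i : ℕ) : ℝ := (σ2 : ℝ) / M * (lam i)⁻¹

lemma ridge_nonneg {i : ℕ} (hi : 0 < lam i) : 0 ≤ ridge lam σ2 M i := by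
  unfold ridge; positivity

lemma smul_inv_eigenvalueMatrix (hlam : ∀ e < E, 0 < lam e) :
    ((σ2 : ℝ) / M) • (eigenvalueMatrix lam E)⁻¹ = diagonal fun i : Fin E => ridge lam σ2 M i := by
  have h : (eigenvalueMatrix lam E)⁻¹ = diagonal fun i : Fin E => (lam i)⁻¹ := by
    refine inv_eq_left_inv ?_
    rw [eigenvalueMatrix, diagonal_mul_diagonal, ← diagonal_one]
    congr 1
    funext i
    exact inv_mul_cancel₀ (hlam i i.2).ne'
  rw [h, ← diagonal_smul]
  rfl

/-- The empirical Gram matrix of the first `E` eigenfunctions. -/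
def gram (phi : ℕ → X → ℝ) (E M : ℕ) (x : Fin M → X) : Matrix (Fin E) (Fin E) ℝ :=
  Matrix.of fun i j => (1 / (M : ℝ)) * ∑ m, phi i (x m) * phi j (x m)

lemma smul_transpose_mul_designMatrix (x : Fin M → X) :
    (1 / (M : ℝ)) • ((designMatrix phi E M x)ᵀ * designMatrix phi E M x) = gram phi E M x := by
  ext i j
  simp [designMatrix, gram, mul_apply]

/-- The empirical coefficients of the measurements. -/
def empiricalCoeff (phi : ℕ → X → ℝ) (E M : ℕ) (x : Fin M → X) (y : Fin M → ℝ) (i : Fin E) : ℝ :=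
  (1 / (M : ℝ)) * ∑ m, phi i (x m) * y m

lemma smul_transpose_mulVec (x : Fin M → X) (y : Fin M → ℝ) :
    ((1 / (M : ℝ)) • (designMatrix phi E M x)ᵀ) *ᵥ y = empiricalCoeff phi E M x y := by
  funext i
  simp only [smul_mulVec, Pi.smul_apply, smul_eq_mul]
  rfl

lemma matrixHA_mulVec (hlam : ∀ e < E, 0 < lam e) (x : Fin M → X) (y : Fin M → ℝ) :
    matrixHA lam phi σ2 E M x *ᵥ y
      = (gram phi E M x + diagonal fun i : Fin E => ridge lam σ2 M i)⁻¹
        *ᵥ empiricalCoeff phi E M x y := by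
  rw [matrixHA, ← mulVec_mulVec, smul_transpose_mulVec, smul_transpose_mul_designMatrix,
    smul_inv_eigenvalueMatrix hlam]

lemma matrixHB_mulVec (hlam : ∀ e < E, 0 < lam e) (x : Fin M → X) (y : Fin M → ℝ) :
    matrixHB lam phi σ2 E M x *ᵥ y
      = (1 + diagonal fun i : Fin E => ridge lam σ2 M i)⁻¹ *ᵥ empiricalCoeff phi E M x y := by
  rw [matrixHB, ← mulVec_mulVec, smul_transpose_mulVec, smul_inv_eigenvalueMatrix hlam]

lemma estimatorA_eq (x : Fin M → X) (y : Fin M → ℝ) (t : X) :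
    estimatorA lam phi σ2 E M x y t = ∑ i, (matrixHA lam phi σ2 E M x *ᵥ y) i * phi i t := by
  rw [estimatorA, dotProduct_comm]; rfl

lemma estimatorB_eq (x : Fin M → X) (y : Fin M → ℝ) (t : X) :
    estimatorB lam phi σ2 E M x y t = ∑ i, (matrixHB lam phi σ2 E M x *ᵥ y) i * phi i t := by
  rw [estimatorB, dotProduct_comm]; rfl

/-- The perturbation bound with `T = 1`: the residual at `a` is the ridge term minus the error of
the empirical coefficient. The `8` is the factor `4` times the `2` of `(p - q)² ≤ 2p² + 2q²`. -/
lemma sum_sub_matrixHB_sq_le (hlam : ∀ e < E, 0 < lam e) (x : Fin M → X) (y : Fin M → ℝ)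
    (a : Fin E → ℝ) :
    ∑ i, (a i - (matrixHB lam phi σ2 E M x *ᵥ y) i) ^ 2
      ≤ ∑ i : Fin E, (8 * (ridge lam σ2 M i ^ 2 * a i ^ 2)
        + 8 * ((1 / (M : ℝ)) * ∑ m, phi i (x m) * y m - a i) ^ 2) := by
  rw [matrixHB_mulVec hlam]
  refine (sum_sub_inv_mulVec_sq_le (T := 1) (d := fun i : Fin E => ridge lam σ2 M i)
    (fun i => ridge_nonneg (hlam i i.2)) (by simp)
    _ a).trans ?_
  rw [Finset.mul_sum]
  refine Finset.sum_le_sum fun i _ => ?_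
  rw [add_mulVec, one_mulVec, Pi.add_apply, mulVec_diagonal, empiricalCoeff]
  nlinarith [sq_nonneg (ridge lam σ2 M i * a i
    + ((1 / (M : ℝ)) * ∑ m, phi i (x m) * y m - a i))]

/-- The normal equations at `a` leave `ridge * a - Gᵀ(y - G a)/M`. When `a` holds the true
coefficients, `y - G a` is noise plus the part of `f` orthogonal to the `φ_i`, so its empirical
coefficients estimate `0`; the term `- 0` fits the form used for empirical means. -/
lemma sum_sub_matrixHA_sq_le (hlam : ∀ e < E, 0 < lam e) (x : Fin M → X) (y : Fin M → ℝ)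
    (hx : ∑ i, ∑ j, (gram phi E M x i j - (1 : Matrix (Fin E) (Fin E) ℝ) i j) ^ 2 ≤ 1 / 4)
    (a : Fin E → ℝ) :
    ∑ i, (a i - (matrixHA lam phi σ2 E M x *ᵥ y) i) ^ 2
      ≤ ∑ i : Fin E, (8 * (ridge lam σ2 M i ^ 2 * a i ^ 2)
        + 8 * ((1 / (M : ℝ)) * ∑ m, phi i (x m) * (y m - ∑ j, a j * phi j (x m)) - 0) ^ 2) := by
  rw [matrixHA_mulVec hlam]
  refine (sum_sub_inv_mulVec_sq_le (d := fun i : Fin E => ridge lam σ2 M i)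
    (fun i => ridge_nonneg (hlam i i.2)) hx _ a).trans ?_
  rw [Finset.mul_sum]
  refine Finset.sum_le_sum fun i _ => ?_
  have h : (1 / (M : ℝ)) * ∑ m, phi i (x m) * (y m - ∑ j, a j * phi j (x m))
      = empiricalCoeff phi E M x y i - (gram phi E M x *ᵥ a) i := by
    simp only [mul_sub, Finset.sum_sub_distrib, empiricalCoeff, mulVec, dotProduct, gram, of_apply]
    congr 1
    simp only [Finset.mul_sum, Finset.sum_mul]
    rw [Finset.sum_comm]
    exact Finset.sum_congr rfl fun j _ => Finset.sum_congr rfl fun m _ => by ring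
  rw [add_mulVec, Pi.add_apply, mulVec_diagonal, h]
  nlinarith [sq_nonneg (ridge lam σ2 M i * a i
    + (empiricalCoeff phi E M x y i - (gram phi E M x *ᵥ a) i))]

end Estimators

/-! ### Pairwise joint laws from mutual independence -/

section Sample

variable {X Ω W : Type*} [mX : MeasurableSpace X] [mΩ : MeasurableSpace Ω] [mW : MeasurableSpace W]
  {P : Measure Ω} [IsProbabilityMeasure P] {μ : Measure X} [IsProbabilityMeasure μ] {σ2 : ℝ≥0}
  {g : Ω → W} {xs : ℕ → Ω → X} {nu : ℕ → Ω → ℝ}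

/-- Inputs and noises form a pairwise independent sample, independent of `g`. -/
structure IsSample (P : Measure Ω) (μ : Measure X) (σ2 : ℝ≥0) (g : Ω → W) (xs : ℕ → Ω → X)
    (nu : ℕ → Ω → ℝ) : Prop where
  measurable_param : Measurable g
  measurable_input : ∀ m, Measurable (xs m)
  measurable_noise : ∀ m, Measurable (nu m)
  map_one : ∀ m, P.map (fun ω => (g ω, (xs m ω, nu m ω)))
    = (P.map g).prod (μ.prod (gaussianReal 0 σ2))
  map_two : ∀ m n, m ≠ n → P.map (fun ω => (g ω, (xs m ω, nu m ω), (xs n ω, nu n ω)))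
    = (P.map g).prod ((μ.prod (gaussianReal 0 σ2)).prod (μ.prod (gaussianReal 0 σ2)))
  indepFun_inputs : ∀ M, IndepFun g (inputs xs M) P

lemma measurable_inputs (hx : ∀ m, Measurable (xs m)) (M : ℕ) : Measurable (inputs xs M) :=
  measurable_pi_lambda _ fun m => hx m

lemma indepFun_of_measurable_iSup {ι β γ : Type*} {m : ι → MeasurableSpace Ω}
    [mβ : MeasurableSpace β] [mγ : MeasurableSpace γ] (hm : ∀ i, m i ≤ mΩ) (hi : iIndep m P)
    {S T : Set ι} (hST : Disjoint S T) {A : Ω → β} {B : Ω → γ}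
    (hA : Measurable[⨆ i ∈ S, m i] A) (hB : Measurable[⨆ i ∈ T, m i] B) : IndepFun A B P := by
  rw [IndepFun_iff_Indep]
  exact indep_of_indep_of_le_right (indep_of_indep_of_le_left (indep_iSup_of_disjoint hm hi hST)
    (@Measurable.comap_le _ _ _ _ _ hA)) (@Measurable.comap_le _ _ _ _ _ hB)

lemma isSample_of_iIndep (hg : Measurable g) (hx : ∀ m, Measurable (xs m))
    (hn : ∀ m, Measurable (nu m)) (lx : ∀ m, P.map (xs m) = μ)
    (ln : ∀ m, P.map (nu m) = gaussianReal 0 σ2)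
    (hi : iIndep (Sum.elim (fun _ : Unit => mW.comap g)
      (Sum.elim (fun m : ℕ => mX.comap (xs m))
        (fun m : ℕ => Real.measurableSpace.comap (nu m)))) P) :
    IsSample P μ σ2 g xs nu := by
  set fam := Sum.elim (fun _ : Unit => mW.comap g)
      (Sum.elim (fun m : ℕ => mX.comap (xs m))
        (fun m : ℕ => Real.measurableSpace.comap (nu m))) with hfam
  have hle : ∀ i, fam i ≤ mΩ := by
    rintro (_ | m | m)
    · exact hg.comap_le
    · exact (hx m).comap_le
    · exact (hn m).comap_le
  have mg : ∀ {S : Set (Unit ⊕ ℕ ⊕ ℕ)}, Sum.inl () ∈ S → Measurable[⨆ i ∈ S, fam i] g :=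
    fun {S} hS => Measurable.of_comap_le (le_iSup₂_of_le (f := fun i _ => fam i) _ hS le_rfl)
  have mx : ∀ {S : Set (Unit ⊕ ℕ ⊕ ℕ)} (m : ℕ), Sum.inr (Sum.inl m) ∈ S →
      Measurable[⨆ i ∈ S, fam i] (xs m) :=
    fun {S} m hS => Measurable.of_comap_le (le_iSup₂_of_le (f := fun i _ => fam i) _ hS le_rfl)
  have mn : ∀ {S : Set (Unit ⊕ ℕ ⊕ ℕ)} (m : ℕ), Sum.inr (Sum.inr m) ∈ S →
      Measurable[⨆ i ∈ S, fam i] (nu m) :=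
    fun {S} m hS => Measurable.of_comap_le (le_iSup₂_of_le (f := fun i _ => fam i) _ hS le_rfl)
  have hxn : ∀ m, Measurable fun ω => (xs m ω, nu m ω) := fun m => (hx m).prodMk (hn m)
  have law : ∀ m, P.map (fun ω => (xs m ω, nu m ω)) = μ.prod (gaussianReal 0 σ2) := fun m => by
    have h : IndepFun (xs m) (nu m) P := indepFun_of_measurable_iSup hle hi
      (S := {Sum.inr (Sum.inl m)}) (T := {Sum.inr (Sum.inr m)}) (by simp)
      (mx m rfl) (mn m rfl)
    rw [h.map_prod_eq_prod_map_map (hx m).aemeasurable (hn m).aemeasurable, lx, ln]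
  have hdis : Disjoint {Sum.inl ()} (Set.range (Sum.inr : ℕ ⊕ ℕ → Unit ⊕ ℕ ⊕ ℕ)) := by simp
  refine ⟨hg, hx, hn, fun m => ?_, fun m n hmn => ?_, fun M => ?_⟩
  · have h : IndepFun g (fun ω => (xs m ω, nu m ω)) P :=
      indepFun_of_measurable_iSup hle hi hdis (mg rfl)
        (Measurable.prodMk (mx m ⟨_, rfl⟩) (mn m ⟨_, rfl⟩))
    rw [h.map_prod_eq_prod_map_map hg.aemeasurable (hxn m).aemeasurable, law]
  · have h : IndepFun g (fun ω => ((xs m ω, nu m ω), (xs n ω, nu n ω))) P :=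
      indepFun_of_measurable_iSup hle hi hdis (mg rfl)
        (Measurable.prodMk (Measurable.prodMk (mx m ⟨_, rfl⟩) (mn m ⟨_, rfl⟩))
          (Measurable.prodMk (mx n ⟨_, rfl⟩) (mn n ⟨_, rfl⟩)))
    have h2 : IndepFun (fun ω => (xs m ω, nu m ω)) (fun ω => (xs n ω, nu n ω)) P :=
      indepFun_of_measurable_iSup hle hi
        (S := {Sum.inr (Sum.inl m), Sum.inr (Sum.inr m)})
        (T := {Sum.inr (Sum.inl n), Sum.inr (Sum.inr n)}) (by simp [hmn.symm])
        (Measurable.prodMk (mx m (by simp)) (mn m (by simp)))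
        (Measurable.prodMk (mx n (by simp)) (mn n (by simp)))
    rw [h.map_prod_eq_prod_map_map hg.aemeasurable ((hxn m).prodMk (hxn n)).aemeasurable,
      h2.map_prod_eq_prod_map_map (hxn m).aemeasurable (hxn n).aemeasurable, law, law]
  · exact indepFun_of_measurable_iSup hle hi hdis (mg rfl)
      (@measurable_pi_lambda _ _ _ (_) _ _ fun m => mx m ⟨_, rfl⟩)

end Sample

/-! ### Splitting the conditional error, and the lower bound -/

section Error

variable {X Ω W : Type*} [TopologicalSpace X] [CompactSpace X] [SecondCountableTopology X]
  [MeasurableSpace X] [BorelSpace X] [MeasurableSpace Ω] [MeasurableSpace W]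
  {P : Measure Ω} [IsProbabilityMeasure P] {μ : Measure X} [IsProbabilityMeasure μ]
  {K : X → X → ℝ} {lam : ℕ → ℝ} {phi : ℕ → X → ℝ} {σ2 : ℝ≥0} {F : X → W → ℝ}
  {g : Ω → W} {xs : ℕ → Ω → X} {nu : ℕ → Ω → ℝ} {k : ℝ} {E : ℕ}

lemma IsSample.isProbabilityMeasure_map (hs : IsSample P μ σ2 g xs nu) :
    IsProbabilityMeasure (P.map g) := Measure.isProbabilityMeasure_map hs.measurable_param.aemeasurable

/-- The residual is a function of `g` alone, which is independent of the inputs. -/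
lemma IsSample.condLExp_residual (hs : IsSample P μ σ2 g xs nu)
    (hF : HasSecondMoment (P.map g) K F) (hK : Continuous (Function.uncurry K))
    {ι : Type*} [Fintype ι] [DecidableEq ι] {v : ι → X → ℝ} (hv : IsOrthonormalFamily μ v) (M : ℕ) :
    condLExp (MeasurableSpace.comap (inputs xs M) MeasurableSpace.pi) P
        (fun ω => ENNReal.ofReal (residual μ v fun x => F x (g ω)))
      =ᵐ[P] fun _ => ENNReal.ofReal (∫ w, residual μ v (fun x => F x w) ∂(P.map g)) := by
  have := hs.isProbabilityMeasure_map
  refine (condLExp_comp_of_indepFun hs.measurable_param (measurable_inputs hs.measurable_input M)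
    (hs.indepFun_inputs M) (hF.measurable_residual hv).ennreal_ofReal).trans
    (ae_of_all _ fun _ => ?_)
  simp only
  rw [ofReal_integral_eq_lintegral_ofReal (hF.integrable_residual hK hv)
    ((hF.ae_memLp hK).mono fun w hw => hv.residual_nonneg hw)]

lemma IsSample.ae_memLp (hs : IsSample P μ σ2 g xs nu) (hF : HasSecondMoment (P.map g) K F)
    (hK : Continuous (Function.uncurry K)) : ∀ᵐ ω ∂P, MemLp (fun x => F x (g ω)) 2 μ := by
  have := hs.isProbabilityMeasure_map
  exact ae_of_ae_map hs.measurable_param.aemeasurable (hF.ae_memLp hK)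

/-- The error of an estimator with values in the span of the first `E` eigenfunctions. -/
lemma IsSample.condError_ae_eq (hs : IsSample P μ σ2 g xs nu)
    (hF : HasSecondMoment (P.map g) K F) (hK : Continuous (Function.uncurry K))
    (h : IsKLExpansion μ K lam phi) (hk : ∀ e, 0 < lam e → ∀ x, |phi e x| ≤ √k)
    (hlam : ∀ e < E, 0 < lam e) {M : ℕ} {fhat : (Fin M → X) → (Fin M → ℝ) → X → ℝ}
    {b : (Fin M → X) → (Fin M → ℝ) → Fin E → ℝ}
    (hfhat : ∀ x y t, fhat x y t = ∑ i : Fin E, b x y i * phi i t) :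
    condError P μ (fun x ω => F x (g ω)) xs nu M fhat =ᵐ[P] fun ω =>
      ENNReal.ofReal (∑' e, lam (E + e))
        + condLExp (MeasurableSpace.comap (inputs xs M) MeasurableSpace.pi) P
          (fun ω => ENNReal.ofReal (∑ i : Fin E, (coeff μ F (phi i) (g ω)
            - b (inputs xs M ω) (measurements (fun x ω => F x (g ω)) xs nu M ω) i) ^ 2)) ω := by
  have := hs.isProbabilityMeasure_map
  have hv := h.isOrthonormalFamily hlam
  have hres : AEMeasurable (fun ω => ENNReal.ofReal
      (residual μ (fun i : Fin E => phi i) fun x => F x (g ω))) P :=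
    ((hF.measurable_residual hv).comp hs.measurable_param).ennreal_ofReal.aemeasurable
  have h1 : (fun ω => sqNorm μ fun t => F t (g ω)
        - fhat (inputs xs M ω) (measurements (fun x ω => F x (g ω)) xs nu M ω) t)
      =ᵐ[P] (fun ω => ENNReal.ofReal (residual μ (fun i : Fin E => phi i) fun x => F x (g ω)))
        + fun ω => ENNReal.ofReal (∑ i : Fin E, (coeff μ F (phi i) (g ω)
          - b (inputs xs M ω) (measurements (fun x ω => F x (g ω)) xs nu M ω) i) ^ 2) := by
    filter_upwards [hs.ae_memLp hF hK] with ω hω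
    simp_rw [hfhat]
    exact hv.sqNorm_sub hω _
  refine (condLExp_congr_ae h1).trans ((condLExp_add_left _ hres).trans ?_)
  filter_upwards [hs.condLExp_residual hF hK hv M] with ω hω
  rw [Pi.add_apply, hω, hF.integral_residual_phi hK h hk hlam]

/-- For almost every outcome the residual bounds the squared distance from `f` to every measurable
element of `V`, however it was chosen from the data. -/
lemma IsSample.tail_le_condError (hs : IsSample P μ σ2 g xs nu)
    (hF : HasSecondMoment (P.map g) K F) (hK : Continuous (Function.uncurry K))
    (h : IsKLExpansion μ K lam phi) (hk : ∀ e, 0 < lam e → ∀ x, |phi e x| ≤ √k)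
    {M : ℕ} (V : Submodule ℝ (X → ℝ)) [FiniteDimensional ℝ V] (hV : Module.finrank ℝ V ≤ E)
    {fhat : (Fin M → X) → (Fin M → ℝ) → X → ℝ}
    (hm : Measurable (fun p : (Fin M → X) × (Fin M → ℝ) × X => fhat p.1 p.2.1 p.2.2))
    (hfV : ∀ x y, fhat x y ∈ V) :
    ∀ᵐ ω ∂P, ENNReal.ofReal (∑' e, lam (E + e))
      ≤ condError P μ (fun x ω => F x (g ω)) xs nu M fhat ω := by
  have := hs.isProbabilityMeasure_map
  obtain ⟨n, hn, v, hv, hspan⟩ := exists_isOrthonormalFamily μ V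
  have h1 : (fun ω => ENNReal.ofReal (residual μ v fun x => F x (g ω))) ≤ᵐ[P]
      fun ω => sqNorm μ fun t => F t (g ω)
        - fhat (inputs xs M ω) (measurements (fun x ω => F x (g ω)) xs nu M ω) t := by
    filter_upwards [hs.ae_memLp hF hK] with ω hω
    set u := fhat (inputs xs M ω) (measurements (fun x ω => F x (g ω)) xs nu M ω) with hu
    have hum : AEStronglyMeasurable u μ :=
      (hm.comp (measurable_const.prodMk (measurable_const.prodMk measurable_id))).aestronglyMeasurable
    -- An estimate at finite distance from `f` is itself in `L²`, hence almost everywhere a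
    -- combination of the `v i`.
    by_cases htop : sqNorm μ (fun t => F t (g ω) - u t) = ∞
    · rw [htop]; exact le_top
    · have hd := memLp_of_sqNorm_ne_top (hω.aestronglyMeasurable.sub hum) htop
      have huL : MemLp u 2 μ := by
        have := hω.sub hd
        convert this using 1
        funext t
        simp
      obtain ⟨b, hb⟩ := hspan u (hfV _ _) huL
      rw [sqNorm_congr (hb.mono fun t ht => congrArg (F t (g ω) - ·) ht :
        (fun t => F t (g ω) - u t) =ᵐ[μ] fun t => F t (g ω) - ∑ i, b i * v i t), hv.sqNorm_sub hω]
      exact le_self_add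
  filter_upwards [condLExp_mono h1, hs.condLExp_residual hF hK hv M] with ω h2 h3
  refine le_trans ?_ h2
  rw [h3]
  exact ENNReal.ofReal_le_ofReal
    (hF.tail_le_integral_residual hK h hk hv (by simpa using hn.trans hV))

end Error

/-! ### Consistency of the two estimators -/

section Consistency

variable {X Ω W : Type*} [TopologicalSpace X] [CompactSpace X] [SecondCountableTopology X]
  [MeasurableSpace X] [BorelSpace X] [MeasurableSpace Ω] [MeasurableSpace W]
  {P : Measure Ω} [IsProbabilityMeasure P] {μ : Measure X} [IsProbabilityMeasure μ]
  {K : X → X → ℝ} {lam : ℕ → ℝ} {phi : ℕ → X → ℝ} {σ2 : ℝ≥0} {F : X → W → ℝ}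
  {g : Ω → W} {xs : ℕ → Ω → X} {nu : ℕ → Ω → ℝ} {k : ℝ} {E : ℕ}

lemma IsSample.empirical_mean (hs : IsSample P μ σ2 g xs nu) {h : W × X × ℝ → ℝ}
    (hh : Measurable h) (hL : MemLp h 2 ((P.map g).prod (μ.prod (gaussianReal 0 σ2))))
    {hbar : W → ℝ}
    (hbar_eq : ∀ᵐ w ∂(P.map g), ∫ z, h (w, z) ∂(μ.prod (gaussianReal 0 σ2)) = hbar w) :
    ∃ C : ℝ, ∀ M : ℕ, 0 < M →
      Integrable (fun ω => ((1 / (M : ℝ)) * ∑ m : Fin M, h (g ω, (xs m ω, nu m ω))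
        - hbar (g ω)) ^ 2) P ∧
      ∫ ω, ((1 / (M : ℝ)) * ∑ m : Fin M, h (g ω, (xs m ω, nu m ω)) - hbar (g ω)) ^ 2 ∂P
        ≤ C / M := by
  have := hs.isProbabilityMeasure_map
  exact ⟨_, fun M hM => integral_empirical_mean_sub_sq_le hs.measurable_param
    (fun m => (hs.measurable_input m).prodMk (hs.measurable_noise m)) hs.map_one hs.map_two
    hh hL hbar_eq M hM⟩

/-- Noisy empirical coefficients of a random function along an eigenfunction. -/
lemma IsSample.empirical_coeff (hs : IsSample P μ σ2 g xs nu) (h : IsKLExpansion μ K lam phi)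
    (hk : ∀ e, 0 < lam e → ∀ x, |phi e x| ≤ √k) {i : ℕ} (hi : 0 < lam i)
    {u : W × X → ℝ} (hu : Measurable u) (huL : MemLp u 2 ((P.map g).prod μ)) {hbar : W → ℝ}
    (hbar_eq : ∀ᵐ w ∂(P.map g), ∫ x, u (w, x) * phi i x ∂μ = hbar w) :
    ∃ C : ℝ, ∀ M : ℕ, 0 < M →
      Integrable (fun ω => ((1 / (M : ℝ)) * ∑ m : Fin M,
        phi i (xs m ω) * (u (g ω, xs m ω) + nu m ω) - hbar (g ω)) ^ 2) P ∧
      ∫ ω, ((1 / (M : ℝ)) * ∑ m : Fin M,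
        phi i (xs m ω) * (u (g ω, xs m ω) + nu m ω) - hbar (g ω)) ^ 2 ∂P ≤ C / M := by
  have := hs.isProbabilityMeasure_map
  have hp := h.measurable_phi hi
  have hmul : Measurable fun p : W × X × ℝ => u (p.1, p.2.1) + p.2.2 :=
    (hu.comp (measurable_fst.prodMk measurable_snd.fst)).add measurable_snd.snd
  have hmeas : Measurable fun p : W × X × ℝ => phi i p.2.1 * (u (p.1, p.2.1) + p.2.2) :=
    (hp.comp measurable_snd.fst).mul hmul
  have hLu : MemLp (fun p : W × X × ℝ => u (p.1, p.2.1) + p.2.2) 2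
      ((P.map g).prod (μ.prod (gaussianReal 0 σ2))) := by
    refine MemLp.add (f := fun p : W × X × ℝ => u (p.1, p.2.1)) (g := fun p : W × X × ℝ => p.2.2)
      ?_ ?_
    · exact huL.comp_measurePreserving ((MeasurePreserving.id _).prod measurePreserving_fst)
    · exact (memLp_id_gaussianReal (μ := 0) (v := σ2) 2).comp_measurePreserving
        (measurePreserving_snd.comp (measurePreserving_snd (μ := P.map g)
          (ν := μ.prod (gaussianReal 0 σ2))))
  refine hs.empirical_mean hmeas
    (hLu.of_le_mul (c := √k) hmeas.aestronglyMeasurable (ae_of_all _ fun p => ?_)) ?_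
  · rw [norm_mul]
    exact mul_le_mul_of_nonneg_right (hk i hi _) (norm_nonneg _)
  · filter_upwards [hbar_eq, huL.integrable_sq.prod_right_ae] with w hw hw2
    have hwL : MemLp (fun x => u (w, x)) 2 μ := (memLp_two_iff_integrable_sq
      (hu.comp measurable_prodMk_left).aestronglyMeasurable).2 hw2
    have i1 : Integrable (fun x => u (w, x) * phi i x) μ := hwL.integrable_mul (h.memLp_phi hi 2)
    have i2 : Integrable (fun r : ℝ => r) (gaussianReal 0 σ2) :=
      (memLp_id_gaussianReal (μ := 0) (v := σ2) 1).integrable le_rfl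
    have i3 : Integrable (fun z : X × ℝ => phi i z.1 * z.2) (μ.prod (gaussianReal 0 σ2)) :=
      ((h.memLp_phi hi 1).integrable le_rfl).mul_prod i2
    -- The noise is centered and independent of the input, so it does not contribute to the mean.
    have h1 : ∀ z : X × ℝ, phi i z.1 * (u (w, z.1) + z.2)
        = u (w, z.1) * phi i z.1 + phi i z.1 * z.2 := fun z => by ring
    simp_rw [h1]
    rw [integral_add (i1.comp_fst _) i3, integral_fun_fst (fun x => u (w, x) * phi i x),
      integral_prod_mul (fun x => phi i x) (fun r : ℝ => r), integral_id_gaussianReal, hw]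
    simp

lemma IsSample.empirical_gram (hs : IsSample P μ σ2 g xs nu) (h : IsKLExpansion μ K lam phi)
    (hlam : ∀ e < E, 0 < lam e) (i j : Fin E) :
    ∃ C : ℝ, ∀ M : ℕ, 0 < M →
      Integrable (fun ω => (gram phi E M (inputs xs M ω) i j
        - (1 : Matrix (Fin E) (Fin E) ℝ) i j) ^ 2) P ∧
      ∫ ω, (gram phi E M (inputs xs M ω) i j - (1 : Matrix (Fin E) (Fin E) ℝ) i j) ^ 2 ∂P
        ≤ C / M := by
  have := hs.isProbabilityMeasure_map
  have hL : MemLp (fun x => phi i x * phi j x) 2 μ :=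
    -- Hölder with `1/4 + 1/4 = 1/2`.
    (h.memLp_phi (hlam j j.2) 4).mul (h.memLp_phi (hlam i i.2) 4) (hpqr := ⟨by
      rw [← two_mul, ← ENNReal.toReal_eq_toReal_iff' (by finiteness) (by finiteness)]; norm_num⟩)
  have hm : Measurable fun x => phi i x * phi j x :=
    (h.measurable_phi (hlam i i.2)).mul (h.measurable_phi (hlam j j.2))
  refine hs.empirical_mean (h := fun p => phi i p.2.1 * phi j p.2.1)
    (hbar := fun _ => (1 : Matrix (Fin E) (Fin E) ℝ) i j) (hm.comp measurable_snd.fst) ?_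
    (ae_of_all _ fun w => ?_)
  · exact hL.comp_measurePreserving (measurePreserving_fst.comp (measurePreserving_snd
      (μ := P.map g) (ν := μ.prod (gaussianReal 0 σ2))))
  · simp only
    rw [integral_fun_fst (fun x => phi i x * phi j x),
      (h.isOrthonormalFamily hlam).orthonormal i j, one_apply]
    simp

/-- The inputs for which the empirical Gram matrix is within `1 / 2` of the identity. -/
def goodInputs (phi : ℕ → X → ℝ) (E M : ℕ) : Set (Fin M → X) :=
  {x | ∑ i, ∑ j, (gram phi E M x i j - (1 : Matrix (Fin E) (Fin E) ℝ) i j) ^ 2 ≤ 1 / 4}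

lemma measurableSet_goodInputs (h : IsKLExpansion μ K lam phi) (hlam : ∀ e < E, 0 < lam e) (M : ℕ) :
    MeasurableSet (goodInputs phi E M) := by
  refine measurableSet_le (Finset.measurable_sum _ fun i _ => Finset.measurable_sum _ fun j _ =>
    Measurable.pow_const (Measurable.sub ?_ measurable_const) 2) measurable_const
  refine Measurable.const_mul (Finset.measurable_sum _ fun m _ => ?_) _
  exact ((h.measurable_phi (hlam i i.2)).comp (measurable_pi_apply m)).mul
    ((h.measurable_phi (hlam j j.2)).comp (measurable_pi_apply m))

lemma tendsto_sum_const_div {ι : Type*} [Fintype ι] (C : ι → ℝ) :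
    Tendsto (fun M : ℕ => ∑ i, C i / (M : ℝ)) atTop (𝓝 0) := by
  simpa using tendsto_finsetSum Finset.univ fun i _ =>
    tendsto_const_div_atTop_nhds_zero_nat (C i)

/-- Markov's inequality at level `1/4` for the squared Frobenius distance to the identity, whose
mean is `O(1/M)`. -/
lemma IsSample.tendsto_measure_badInputs (hs : IsSample P μ σ2 g xs nu)
    (h : IsKLExpansion μ K lam phi) (hlam : ∀ e < E, 0 < lam e) :
    Tendsto (fun M => P (inputs xs M ⁻¹' goodInputs phi E M)ᶜ) atTop (𝓝 0) := by
  choose C hC using fun p : Fin E × Fin E => hs.empirical_gram h hlam p.1 p.2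
  have hlim : Tendsto (fun M : ℕ => ENNReal.ofReal (∑ p, C p / (M : ℝ)) / ENNReal.ofReal (1 / 4))
      atTop (𝓝 0) := by
    have := ENNReal.tendsto_ofReal (tendsto_sum_const_div C)
    rw [ENNReal.ofReal_zero] at this
    simpa using ENNReal.Tendsto.div_const this (b := ENNReal.ofReal (1 / 4))
      (Or.inr (by norm_num))
  refine tendsto_of_tendsto_of_tendsto_of_le_of_le' tendsto_const_nhds hlim
    (Eventually.of_forall fun _ => zero_le) ?_
  filter_upwards [eventually_gt_atTop 0] with M hM
  let Y : Ω → ℝ := fun ω => ∑ p : Fin E × Fin E, (gram phi E M (inputs xs M ω) p.1 p.2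
    - (1 : Matrix (Fin E) (Fin E) ℝ) p.1 p.2) ^ 2
  have hY : Integrable Y P := integrable_finsetSum _ fun p _ => (hC p M hM).1
  have hY0 : ∀ ω, 0 ≤ Y ω := fun ω => Finset.sum_nonneg fun p _ => sq_nonneg _
  calc P (inputs xs M ⁻¹' goodInputs phi E M)ᶜ
      ≤ P {ω | ENNReal.ofReal (1 / 4) ≤ ENNReal.ofReal (Y ω)} := by
        refine measure_mono fun ω hω => ?_
        have : ¬ Y ω ≤ 1 / 4 := by
          intro hle
          refine hω ?_
          exact (Fintype.sum_prod_type' fun i j => (gram phi E M (inputs xs M ω) i j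
            - (1 : Matrix (Fin E) (Fin E) ℝ) i j) ^ 2).symm.trans_le hle
        exact ENNReal.ofReal_le_ofReal (not_le.1 this).le
    _ ≤ (∫⁻ ω, ENNReal.ofReal (Y ω) ∂P) / ENNReal.ofReal (1 / 4) :=
        meas_ge_le_lintegral_div hY.aemeasurable.ennreal_ofReal (by norm_num) (by norm_num)
    _ ≤ ENNReal.ofReal (∑ p, C p / (M : ℝ)) / ENNReal.ofReal (1 / 4) := by
        rw [← ofReal_integral_eq_lintegral_ofReal hY (ae_of_all _ hY0),
          integral_finsetSum _ fun p _ => (hC p M hM).1]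
        gcongr with p
        exact (hC p M hM).2

/-- The last step common to both estimators: the ridge terms have mean `ridge² λ_i = O(1/M²)` and
the empirical errors `D` have mean `O(1/M)`. -/
lemma IsSample.tendsto_setLIntegral_ridge_bound (hs : IsSample P μ σ2 g xs nu)
    (hF : HasSecondMoment (P.map g) K F) (hK : Continuous (Function.uncurry K))
    (h : IsKLExpansion μ K lam phi) (hk : ∀ e, 0 < lam e → ∀ x, |phi e x| ≤ √k)
    (hlam : ∀ e < E, 0 < lam e) {A : ℕ → Ω → ℝ} {D : Fin E → ℕ → Ω → ℝ} {S : ℕ → Set Ω}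
    (hD : ∀ i, ∃ C : ℝ, ∀ M : ℕ, 0 < M → Integrable (D i M) P ∧ ∫ ω, D i M ω ∂P ≤ C / M)
    (hD0 : ∀ i M ω, 0 ≤ D i M ω) (hS : ∀ M, MeasurableSet (S M))
    (hA : ∀ M, ∀ ω ∈ S M, A M ω ≤ ∑ i : Fin E,
      (8 * (ridge lam σ2 M i ^ 2 * coeff μ F (phi i) (g ω) ^ 2) + 8 * D i M ω)) :
    Tendsto (fun M => ∫⁻ ω in S M, ENNReal.ofReal (A M ω) ∂P) atTop (𝓝 0) := by
  have := hs.isProbabilityMeasure_map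
  choose C hC using hD
  have hci : ∀ i : Fin E, Integrable (fun ω => coeff μ F (phi i) (g ω) ^ 2) P := fun i =>
    (hF.integrable_coeff_sq hK ((h.memLp_phi (hlam i i.2) 1).integrable le_rfl)).comp_measurable
      hs.measurable_param
  have hce : ∀ i : Fin E, ∫ ω, coeff μ F (phi i) (g ω) ^ 2 ∂P = lam i := fun i => by
    rw [← hF.integral_coeff_phi_sq hK h hk (hlam i i.2), integral_map
      hs.measurable_param.aemeasurable ((hF.measurable_coeff
        (h.measurable_phi (hlam i i.2))).pow_const 2).aestronglyMeasurable]
  have hlim : Tendsto (fun M : ℕ => ENNReal.ofReal (∑ i : Fin E,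
      (8 * (ridge lam σ2 M i ^ 2 * lam i) + 8 * (C i / (M : ℝ))))) atTop (𝓝 0) := by
    rw [← ENNReal.ofReal_zero]
    refine ENNReal.tendsto_ofReal ?_
    have hr : ∀ i : Fin E, Tendsto (fun M : ℕ => ridge lam σ2 M i) atTop (𝓝 0) := fun i => by
      simpa [ridge] using
        (tendsto_const_div_atTop_nhds_zero_nat (σ2 : ℝ)).mul_const (lam i)⁻¹
    have := tendsto_finsetSum (Finset.univ : Finset (Fin E)) fun i _ =>
      ((((hr i).pow 2).mul_const (lam i)).const_mul 8).add
        ((tendsto_const_div_atTop_nhds_zero_nat (C i)).const_mul 8)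
    simpa using this
  refine tendsto_of_tendsto_of_tendsto_of_le_of_le' tendsto_const_nhds hlim
    (Eventually.of_forall fun _ => zero_le) ?_
  filter_upwards [eventually_gt_atTop 0] with M hM
  have hi : ∀ i : Fin E, Integrable (fun ω => 8 * (ridge lam σ2 M i ^ 2
      * coeff μ F (phi i) (g ω) ^ 2) + 8 * D i M ω) P := fun i =>
    (((hci i).const_mul _).const_mul _).add ((hC i M hM).1.const_mul _)
  calc ∫⁻ ω in S M, ENNReal.ofReal (A M ω) ∂P
      ≤ ∫⁻ ω in S M, ENNReal.ofReal (∑ i : Fin E,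
        (8 * (ridge lam σ2 M i ^ 2 * coeff μ F (phi i) (g ω) ^ 2) + 8 * D i M ω)) ∂P :=
        setLIntegral_mono' (hS M) fun ω hω => ENNReal.ofReal_le_ofReal (hA M ω hω)
    _ ≤ ∫⁻ ω, ENNReal.ofReal (∑ i : Fin E,
        (8 * (ridge lam σ2 M i ^ 2 * coeff μ F (phi i) (g ω) ^ 2) + 8 * D i M ω)) ∂P :=
        setLIntegral_le_lintegral _ _
    _ = ENNReal.ofReal (∫ ω, ∑ i : Fin E,
        (8 * (ridge lam σ2 M i ^ 2 * coeff μ F (phi i) (g ω) ^ 2) + 8 * D i M ω) ∂P) :=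
        (ofReal_integral_eq_lintegral_ofReal (integrable_finsetSum _ fun i _ => hi i)
          (ae_of_all _ fun ω => Finset.sum_nonneg fun i _ => by
            have := hD0 i M ω
            positivity)).symm
    _ ≤ _ := by
        refine ENNReal.ofReal_le_ofReal ?_
        rw [integral_finsetSum _ fun i _ => hi i]
        refine Finset.sum_le_sum fun i _ => ?_
        rw [integral_add (((hci i).const_mul _).const_mul _) ((hC i M hM).1.const_mul _),
          integral_const_mul, integral_const_mul, integral_const_mul, hce]
        linarith [(hC i M hM).2]

lemma IsSample.tendsto_condError_estimatorB (hs : IsSample P μ σ2 g xs nu)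
    (hF : HasSecondMoment (P.map g) K F) (hK : Continuous (Function.uncurry K))
    (h : IsKLExpansion μ K lam phi) (hk : ∀ e, 0 < lam e → ∀ x, |phi e x| ≤ √k)
    (hlam : ∀ e < E, 0 < lam e) :
    TendstoInMeasure P (fun M : ℕ => condError P μ (fun x ω => F x (g ω)) xs nu M
      (estimatorB lam phi σ2 E M)) atTop fun _ => ENNReal.ofReal (∑' e, lam (E + e)) := by
  have := hs.isProbabilityMeasure_map
  refine tendstoInMeasure_const_add_condLExp
    (fun M => (measurable_inputs hs.measurable_input M).comap_le) ENNReal.ofReal_ne_top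
    (fun M => hs.condError_ae_eq hF hK h hk hlam fun x y t => estimatorB_eq x y t)
    -- The matrix inverted in `f̂_B` does not depend on the inputs, so no exceptional event is
    -- needed.
    (S := fun _ => Set.univ) (fun _ => MeasurableSet.univ) (by simp) ?_
  refine hs.tendsto_setLIntegral_ridge_bound hF hK h hk hlam
    (D := fun i M ω => ((1 / (M : ℝ)) * ∑ m : Fin M,
        phi i (xs m ω) * (F (xs m ω) (g ω) + nu m ω) - coeff μ F (phi i) (g ω)) ^ 2)
    (fun i => ?_) (fun i M ω => sq_nonneg _) (fun _ => MeasurableSet.univ) fun M ω _ => ?_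
  · exact hs.empirical_coeff h hk (hlam i i.2) (u := fun p => F p.2 p.1) hF.measurable_swap
      (hF.memLp_uncurry hK) (ae_of_all _ fun w => rfl)
  · exact sum_sub_matrixHB_sq_le hlam _ _ _

lemma IsSample.tendsto_condError_estimatorA (hs : IsSample P μ σ2 g xs nu)
    (hF : HasSecondMoment (P.map g) K F) (hK : Continuous (Function.uncurry K))
    (h : IsKLExpansion μ K lam phi) (hk : ∀ e, 0 < lam e → ∀ x, |phi e x| ≤ √k)
    (hlam : ∀ e < E, 0 < lam e) :
    TendstoInMeasure P (fun M : ℕ => condError P μ (fun x ω => F x (g ω)) xs nu M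
      (estimatorA lam phi σ2 E M)) atTop fun _ => ENNReal.ofReal (∑' e, lam (E + e)) := by
  have := hs.isProbabilityMeasure_map
  have hv := h.isOrthonormalFamily hlam
  refine tendstoInMeasure_const_add_condLExp
    (fun M => (measurable_inputs hs.measurable_input M).comap_le) ENNReal.ofReal_ne_top
    (fun M => hs.condError_ae_eq hF hK h hk hlam fun x y t => estimatorA_eq x y t)
    (S := fun M => inputs xs M ⁻¹' goodInputs phi E M)
    (fun M => ⟨_, measurableSet_goodInputs h hlam M, rfl⟩)
    (hs.tendsto_measure_badInputs h hlam) ?_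
  let c : Fin E → W → ℝ := fun j w => coeff μ F (phi j) w
  have hcm : ∀ j, Measurable (c j) := fun j => hF.measurable_coeff (hv.measurable j)
  have hcL : ∀ j, MemLp (c j) 2 (P.map g) := fun j =>
    (memLp_two_iff_integrable_sq (hcm j).aestronglyMeasurable).2
      (hF.integrable_coeff_sq hK ((hv.memLp j).integrable one_le_two))
  -- The part of the random function orthogonal to the first `E` eigenfunctions; its coefficients
  -- along them vanish, hence `hbar = 0` below.
  let u : W × X → ℝ := fun p => F p.2 p.1 - ∑ j, c j p.1 * phi j p.2
  have hum : Measurable u := hF.measurable_swap.sub (Finset.measurable_sum _ fun j _ =>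
    ((hcm j).comp measurable_fst).mul ((hv.measurable j).comp measurable_snd))
  have huL : MemLp u 2 ((P.map g).prod μ) := by
    refine (hF.memLp_uncurry hK).sub (memLp_finsetSum _ fun j _ => ?_)
    refine ((hcL j).comp_fst μ).of_le_mul (c := √k) (((hcm j).comp measurable_fst).mul
      ((hv.measurable j).comp measurable_snd)).aestronglyMeasurable (ae_of_all _ fun p => ?_)
    rw [norm_mul, mul_comm]
    exact mul_le_mul_of_nonneg_right (hk j (hlam j j.2) _) (norm_nonneg _)
  refine hs.tendsto_setLIntegral_ridge_bound hF hK h hk hlam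
    (D := fun i M ω => ((1 / (M : ℝ)) * ∑ m : Fin M,
        phi i (xs m ω) * (u (g ω, xs m ω) + nu m ω) - 0) ^ 2)
    (fun i => ?_) (fun i M ω => sq_nonneg _)
    (fun M => measurable_inputs hs.measurable_input M (measurableSet_goodInputs h hlam M))
    fun M ω hω => ?_
  · refine hs.empirical_coeff h hk (hlam i i.2) hum huL (hbar := fun _ => 0) ?_
    filter_upwards [hF.ae_memLp (μ := μ) hK] with w hw
    have i1 : Integrable (fun x => F x w * phi i x) μ := hw.integrable_mul (hv.memLp i)
    have i2 : ∀ j : Fin E, Integrable (fun x => c j w * (phi j x * phi i x)) μ := fun j =>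
      ((hv.memLp j).integrable_mul (hv.memLp i)).const_mul _
    have h1 : ∀ x, u (w, x) * phi i x
        = F x w * phi i x - ∑ j : Fin E, c j w * (phi j x * phi i x) := fun x => by
      simp only [u, sub_mul, Finset.sum_mul, mul_assoc]
    simp_rw [h1]
    rw [integral_sub i1 (integrable_finsetSum _ fun j _ => i2 j),
      integral_finsetSum _ fun j _ => i2 j]
    simp_rw [integral_const_mul, hv.orthonormal]
    simp [c, coeff]
  · refine (sum_sub_matrixHA_sq_le hlam _ _ hω _).trans (le_of_eq ?_)
    refine Finset.sum_congr rfl fun i _ => ?_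
    have h1 : ∀ m : Fin M, measurements (fun x ω => F x (g ω)) xs nu M ω m
        - ∑ j : Fin E, coeff μ F (phi j) (g ω) * phi j (inputs xs M ω m)
        = u (g ω, xs m ω) + nu m ω := fun m => by
      simp only [u, c, measurements, inputs]; ring
    simp_rw [h1]
    rfl

end Consistency

/-! ### From the measurement model to a parametrised random function -/

lemma IsMeasurementModel.hasSecondMoment {X Ω W : Type*} [TopologicalSpace X] [MeasurableSpace X]
    [MeasurableSpace Ω] [MeasurableSpace W] {P : Measure Ω} [IsProbabilityMeasure P]
    {μ : Measure X} {K : X → X → ℝ} {σ2 : ℝ≥0} {F : X → W → ℝ} {g : Ω → W} {xs : ℕ → Ω → X}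
    {nu : ℕ → Ω → ℝ} (h : IsMeasurementModel P μ K σ2 (fun x ω => F x (g ω)) xs nu)
    (hg : Measurable g) (hF : Measurable (Function.uncurry F)) :
    HasSecondMoment (P.map g) K F := by
  have hFx : ∀ x, Measurable (F x) := fun x => hF.comp measurable_prodMk_left
  have hL : ∀ x, MemLp (fun ω => F x (g ω)) 2 P := fun x => (h.gaussian.hasGaussianLaw_eval x).memLp_two
  refine ⟨hF, fun x => (memLp_map_measure_iff (hFx x).aestronglyMeasurable hg.aemeasurable).2 (hL x),
    fun x x' => ?_⟩
  rw [integral_map (f := fun w => F x w * F x' w) hg.aemeasurable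
    ((hFx x).mul (hFx x')).aestronglyMeasurable, ← h.covariance_eq x x', covariance_eq_sub (hL x) (hL x'), h.mean_zero x]
  simp

/-- In a measurement model the random function depends on a parameter of which the sample is
independent. -/
lemma IsMeasurementModel.exists_isSample {X : Type*} {Ω : Type u} [TopologicalSpace X]
    [mX : MeasurableSpace X] [mΩ : MeasurableSpace Ω] {P : Measure Ω} [IsProbabilityMeasure P]
    {μ : Measure X} [IsProbabilityMeasure μ] {K : X → X → ℝ} {σ2 : ℝ≥0} {f : X → Ω → ℝ}
    {xs : ℕ → Ω → X} {nu : ℕ → Ω → ℝ} (h : IsMeasurementModel P μ K σ2 f xs nu) :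
    ∃ (W : Type u) (_ : MeasurableSpace W) (F : X → W → ℝ) (g : Ω → W),
      (f = fun x ω => F x (g ω)) ∧ HasSecondMoment (P.map g) K F ∧ IsSample P μ σ2 g xs nu := by
  have hx := h.measurable_input
  have hn := h.measurable_noise
  have lx := h.law_input
  have ln := h.law_noise
  obtain ⟨mF, hle, hfm, hind⟩ := h.indep
  have hg : @Measurable Ω Ω mΩ mF id := measurable_id'' hle
  -- The parameter is the outcome itself, seen through `mF`: `g` is the identity from `Ω` to `Ω`
  -- with the smaller σ-algebra.
  refine ⟨Ω, mF, f, id, rfl, ?_, ?_⟩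
  · exact @IsMeasurementModel.hasSecondMoment X Ω Ω _ mX mΩ mF P _ μ K σ2 f id xs nu h hg hfm
  · refine @isSample_of_iIndep X Ω Ω mX mΩ mF P _ μ _ σ2 id xs nu hg hx hn lx ln ?_
    rw [MeasurableSpace.comap_id]
    exact hind

end GPRegression

end

theorem mainTheorem3 {X Ω : Type*} [MetricSpace X] [CompactSpace X] [MeasurableSpace X]
    [BorelSpace X] [MeasurableSpace Ω]
    (μ : Measure X) [IsProbabilityMeasure μ] (P : Measure Ω) [IsProbabilityMeasure P]
    (K : X → X → ℝ) (hK : Continuous (Function.uncurry K))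
    (lam : ℕ → ℝ) (phi : ℕ → X → ℝ) (hKL : GPRegression.IsKLExpansion μ K lam phi)
    (k : ℝ) (hk : ∀ e, 0 < lam e → ∀ x, |phi e x| ≤ √k)
    (σ2 : ℝ≥0) (hσ2 : 0 < σ2)
    (f : X → Ω → ℝ) (xs : ℕ → Ω → X) (nu : ℕ → Ω → ℝ)
    (hmodel : GPRegression.IsMeasurementModel P μ K σ2 f xs nu)
    (E : ℕ) (hE : 0 < E) (hlam : ∀ e < E, 0 < lam e) :
    Summable lam ∧
    -- `Err_A → ∑_{e > E} λ_e` and `Err_B → ∑_{e > E} λ_e` in probability as `M → ∞`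
    TendstoInMeasure P
      (fun M : ℕ => GPRegression.condError P μ f xs nu M
        (GPRegression.estimatorA lam phi σ2 E M))
      atTop (fun _ => ENNReal.ofReal (∑' e, lam (E + e))) ∧
    TendstoInMeasure P
      (fun M : ℕ => GPRegression.condError P μ f xs nu M
        (GPRegression.estimatorB lam phi σ2 E M))
      atTop (fun _ => ENNReal.ofReal (∑' e, lam (E + e))) ∧
    -- no estimator with values in a fixed `E`-dimensional space has, for any `M`, a smaller error
    (∀ (M : ℕ) (V : Submodule ℝ (X → ℝ)), Module.finrank ℝ V = E →
      ∀ fhat : (Fin M → X) → (Fin M → ℝ) → X → ℝ,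
        Measurable (fun p : (Fin M → X) × (Fin M → ℝ) × X => fhat p.1 p.2.1 p.2.2) →
        (∀ x y, fhat x y ∈ V) →
        ∀ᵐ ω ∂P, ENNReal.ofReal (∑' e, lam (E + e)) ≤
          GPRegression.condError P μ f xs nu M fhat ω) := by
  obtain ⟨W, mW, F, g, rfl, hF, hs⟩ := hmodel.exists_isSample
  refine ⟨hKL.summable hK, hs.tendsto_condError_estimatorA hF hK hKL hk hlam,
    hs.tendsto_condError_estimatorB hF hK hKL hk hlam, fun M V hV fhat hm hfV => ?_⟩
  -- `finrank` is `0` by default in infinite dimension, so `0 < E` is what makes `V`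
  -- finite-dimensional.
  have : FiniteDimensional ℝ V := FiniteDimensional.of_finrank_pos (hV ▸ hE)
  exact hs.tail_le_condError hF hK hKL hk V hV.le hm hfV
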